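/- Let $n\ge 2$ and $k\ge 1$ be integers. The symmetric group $S_n$ acts on $\mathbb{C}[x_1,\dots,x_n]$ by permuting the variables. \textbf{The ring.} For a partition $\mu$ with $|\mu|\le n$ and conjugate $\mu'$, put $c_t(\mu)=\mu'_1+\cdots+\mu'_t-t$. Let $I_{n,k,\mu}$ be the ideal generated by $x_1^k,\dots,x_n^k$ and by the elementary symmetric polynomials $e_r(A)$ of degree $r$ in the variables of a subset $A\subseteq\{x_1,\dots,x_n\}$, for all $A$ and $r$ with $c_{n-|A|}(\mu)+(n-|\mu|)<r\le |A|$. Griffin's module is $R_{n,k,\mu}=\mathbb{C}[x_1,\dots,x_n]/I_{n,k,\mu}$, with the induced $S_n$-action. \textbf{Higher Specht polynomials.} Tableaux are in French notation: rows weakly increase from left to right and columns strictly increase from bottom to top. The reading word of a tableau lists its rows from top to bottom, each from left to right. Let $w$ be a word whose content is a partition. Its first standard subword consists of the rightmost $1$ and then, successively, for each chosen letter $j$, the rightmost $j+1$ to the left of it, or the rightmost $j+1$ of $w$ if there is none to the left, until the largest letter is reached. Remove this subword and repeat until all letters are used. In each standard subword label the $1$ with $0$, and, if $j$ has label $c$,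 label $j+1$ with $c$ if it stands to the right of $j$ and with $c+1$ if it stands to the left. For a semistandard tableau $S$ with partition content and a cell $s$, let $\mathrm{cw}_S(s)$ be the label so obtained in the reading word of $S$ for the letter in $s$. For a filling $T$ of the shape of $S$ with $1,\dots,n$, each used once, let $$F_T^S=\sum_{\tau\in C(T)}\sum_{\sigma\in R(T)}\operatorname{sgn}(\tau)\,\tau\sigma\prod_{s}x_{T(s)}^{\mathrm{cw}_S(s)},$$ where $s$ runs over the cells and $C(T)$, $R(T)\subseteq S_n$ are the groups of permutations that preserve each column, respectively each row, of $T$. Let $\mathrm{des}(S)$ be the number of letters $v$ such that some $v$ occurs in $S$ in a strictly lower row than some $v+1$. \textbf{Higher Specht bases.} For a partition $\lambda$ of $n$, let $V_\lambda\subset\mathbb{C}[x_1,\dots,x_n]$ be the Specht module, the span of the Specht polynomials $\prod (x_{T(d)}-x_{T(c)})$ of all fillings $T$ of $\lambda$ with $1,\dots,n$, each used once; the product is over the pairs of cells $c,d$ in a common column with $c$ below $d$. A higher Specht basis of a finite-dimensional $S_n$-module $R$ is a family of elements of $R$ for which there is a decomposition $R=\bigoplus_j W_j$ into finitely many submodules,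 each isomorphic to some $V_{\lambda_j}$ with $\lambda_j$ a partition of $n$, such that the family is a disjoint union of subfamilies, the $j$-th of which is a basis of $W_j$. \textbf{Theorem.} The images in $R_{n,k,(n-1)}$ of the polynomials $$F_T^S\cdot e_1^i,\qquad e_1=x_1+\cdots+x_n,$$ indexed by all triples $(S,T,i)$ where $S$ is a semistandard tableau of content $(n-1,1)$ and any shape $\lambda\vdash n$, $T$ is a standard Young tableau of the same shape $\lambda$, and $i\ge 0$ is an integer with $i<k-\mathrm{des}(S)$, form a higher Specht basis of $R_{n,k,(n-1)}$. In particular they are pairwise distinct and form a basis. -/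

import Mathlib

namespace HigherSpecht

/-! ### Words and cocharge labels

A word is given by a linearly ordered type `P` of positions, a finite set `A` of positions that
are occupied, and the letter `w p` at each position. Letters are positive integers; `⊥` stands for
"no such position". -/

section Words

variable {P : Type*} [LinearOrder P]

/-- The rightmost position of `A` that carries the letter `v`. -/
def rightmost (w : P → ℕ) (A : Finset P) (v : ℕ) : WithBot P :=
  (A.filter fun q => w q = v).max

/-- The cyclically previous `v` before position `p`: the rightmost `v` to the left of `p` if there
is one, and the rightmost `v` of the whole word otherwise. -/
def cprev (w : P → ℕ) (A : Finset P) (v : ℕ) (p : WithBot P) : WithBot P :=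
  if ∃ q ∈ A, w q = v ∧ (q : WithBot P) < p then
    rightmost w (A.filter fun q => (q : WithBot P) < p) v
  else rightmost w A v

/-- `subwordPos w A j` is the position of the letter `j + 1` of the first standard subword. -/
def subwordPos (w : P → ℕ) (A : Finset P) : ℕ → WithBot P
  | 0 => rightmost w A 1
  | j + 1 => cprev w A (j + 2) (subwordPos w A j)

/-- `subwordLabel w A j` is the cocharge label of the letter `j + 1` of the first standard subword:
the letter `1` has label `0`, and the label goes up by one from a letter to the next one exactly
when the next letter stands to the left. -/
def subwordLabel (w : P → ℕ) (A : Finset P) : ℕ → ℕ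
  | 0 => 0
  | j + 1 => subwordLabel w A j + if subwordPos w A (j + 1) < subwordPos w A j then 1 else 0

/-- The set of positions of the first standard subword. -/
def firstSubword (w : P → ℕ) (A : Finset P) : Finset P :=
  A.filter fun p => subwordPos w A (w p - 1) = p

/-- Remove the first standard subword repeatedly, at most `m` times; a position gets its label
in the standard subword that it belongs to. -/
def cochargeLabelAux (w : P → ℕ) : ℕ → Finset P → P → ℕ
  | 0, _, _ => 0
  | m + 1, A, p =>
    if p ∈ firstSubword w A then subwordLabel w A (w p - 1)
    else cochargeLabelAux w m (A \ firstSubword w A) p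

/-- The cocharge word of a word with partition content, as a labelling of its positions. There are
at most `A.card` standard subwords. -/
def cochargeLabel (w : P → ℕ) (A : Finset P) (p : P) : ℕ :=
  cochargeLabelAux w A.card A p

end Words

/-! ### Tableaux

Cells are pairs (row, column), counted from `0`; row `0` is the longest row, which is drawn at the
bottom (French convention). -/

/-- The position of a cell in the reading word, which is read row by row from the top row (largest
row index) to the bottom row, and from left to right in each row. -/
def readingPos (c : ℕ × ℕ) : ℕᵒᵈ ×ₗ ℕ := toLex (OrderDual.toDual c.1, c.2)

/-- The label `cw_S(c)` of the cell `c` in the cocharge word of the reading word of `S`. -/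
def cw {lam : YoungDiagram} (S : SemistandardYoungTableau lam) (c : ℕ × ℕ) : ℕ :=
  cochargeLabel (fun p : ℕᵒᵈ ×ₗ ℕ => S (OrderDual.ofDual (ofLex p).1) (ofLex p).2)
    (lam.cells.image readingPos) (readingPos c)

/-- `S` has positive entries, and the letter `i + 1` occurs as often as the length of the `i`-th
row of `nu` (rows counted from `0`). -/
def HasContent {lam : YoungDiagram} (S : SemistandardYoungTableau lam) (nu : YoungDiagram) : Prop :=
  (∀ c ∈ lam.cells, 1 ≤ S c.1 c.2) ∧
    ∀ i : ℕ, (lam.cells.filter fun c => S c.1 c.2 = i + 1).card = nu.rowLen i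

/-- The number of descents: letters `v` that occur in a lower row than some `v + 1`. -/
def des {lam : YoungDiagram} (S : SemistandardYoungTableau lam) : ℕ :=
  ((lam.cells.image fun c => S c.1 c.2).filter fun v =>
    ∃ c ∈ lam.cells, ∃ d ∈ lam.cells, S c.1 c.2 = v ∧ S d.1 d.2 = v + 1 ∧ c.1 < d.1).card

/-- Fillings of the cells of `lam` with the numbers `1, …, n` (written as elements of `Fin n`),
each used once. -/
abbrev Tab (lam : YoungDiagram) (n : ℕ) : Type := {c : ℕ × ℕ // c ∈ lam.cells} ≃ Fin n

/-- The filling increases along the rows and up the columns. -/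
def Tab.IsStandard {lam : YoungDiagram} {n : ℕ} (T : Tab lam n) : Prop :=
  (∀ c d, c.1.1 = d.1.1 → c.1.2 < d.1.2 → T c < T d) ∧
    ∀ c d, c.1.2 = d.1.2 → c.1.1 < d.1.1 → T c < T d

/-- The group `R(T)` of row permutations, as a finite set. -/
def Tab.rowPerms {lam : YoungDiagram} {n : ℕ} (T : Tab lam n) : Finset (Equiv.Perm (Fin n)) :=
  Finset.univ.filter fun s => ∀ x, (T.symm (s x)).1.1 = (T.symm x).1.1

/-- The group `C(T)` of column permutations, as a finite set. -/
def Tab.colPerms {lam : YoungDiagram} {n : ℕ} (T : Tab lam n) : Finset (Equiv.Perm (Fin n)) :=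
  Finset.univ.filter fun s => ∀ x, (T.symm (s x)).1.2 = (T.symm x).1.2

noncomputable section

open MvPolynomial

variable (K : Type*) [Field K]

/-! ### Higher Specht polynomials and Specht modules -/

/-- The semistandard higher Specht polynomial `F_T^S`: the Young symmetrizer
`∑ sgn(τ) τ σ` (`τ ∈ C(T)`, `σ ∈ R(T)`) applied to the monomial `∏_c x_{T(c)}^{cw_S(c)}`. -/
def higherSpecht {lam : YoungDiagram} {n : ℕ} (S : SemistandardYoungTableau lam) (T : Tab lam n) :
    MvPolynomial (Fin n) K :=
  ∑ t ∈ T.colPerms, ∑ s ∈ T.rowPerms,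
    ((Equiv.Perm.sign t : ℤˣ) : ℤ) • rename (t * s) (∏ c, X (T c) ^ cw S c.1)

/-- The action of the symmetric group on polynomials by permuting the variables. -/
def polyRep (n : ℕ) : Representation K (Equiv.Perm (Fin n)) (MvPolynomial (Fin n) K) where
  toFun s := (rename s).toLinearMap
  map_one' := by
    refine LinearMap.ext fun f => ?_
    simp
  map_mul' s t := by
    refine LinearMap.ext fun f => ?_
    simp [rename_rename]

/-- The Specht polynomial of a filling: the product of the differences of the variables over all
pairs of entries in the same column. -/
def spechtPoly {lam : YoungDiagram} {n : ℕ} (T : Tab lam n) : MvPolynomial (Fin n) K :=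
  ∏ p : {c : ℕ × ℕ // c ∈ lam.cells} × {c : ℕ × ℕ // c ∈ lam.cells} with
    p.1.1.2 = p.2.1.2 ∧ p.1.1.1 < p.2.1.1, (X (T p.2) - X (T p.1))

theorem rename_spechtPoly {lam : YoungDiagram} {n : ℕ} (T : Tab lam n) (s : Equiv.Perm (Fin n)) :
    rename s (spechtPoly K T) = spechtPoly K (T.trans s) := by
  simp [spechtPoly]

/-- The Specht module `V_λ`, spanned by the Specht polynomials of all fillings of `lam`. -/
def spechtModule (n : ℕ) (lam : YoungDiagram) : Subrepresentation (polyRep K n) where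
  toSubmodule := Submodule.span K (Set.range fun T : Tab lam n => spechtPoly K T)
  apply_mem_toSubmodule s f hf := by
    induction hf using Submodule.span_induction with
    | mem x h =>
      obtain ⟨T, rfl⟩ := h
      exact Submodule.subset_span ⟨T.trans s, (rename_spechtPoly K T s).symm⟩
    | zero => simp
    | add x y _ _ hx hy => rw [map_add]; exact Submodule.add_mem _ hx hy
    | smul a x _ hx => rw [map_smul]; exact Submodule.smul_mem _ a hx

variable {K} in
/-- A family `b` in a representation `ρ` of the symmetric group is a higher Specht basis if `ρ` is
the internal direct sum of finitely many subrepresentations `W j`, each isomorphic to a Specht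
module, and the family splits into blocks such that the `j`-th block is a basis of `W j`. -/
def IsHigherSpechtBasis {n : ℕ} {M : Type*} [AddCommGroup M] [Module K M]
    (ρ : Representation K (Equiv.Perm (Fin n)) M) {ι : Type*} (b : ι → M) : Prop :=
  ∃ (J : Type) (_ : Finite J) (shape : J → YoungDiagram) (W : J → Subrepresentation ρ)
    (block : ι → J),
    (∀ j, (shape j).card = n) ∧
    (∀ j, Nonempty
      ((W j).toRepresentation.Equiv (spechtModule K n (shape j)).toRepresentation)) ∧
    iSupIndep (fun j => (W j).toSubmodule) ∧ (⨆ j, (W j).toSubmodule) = ⊤ ∧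
    ∀ j, LinearIndependent K (fun i : {i // block i = j} => b i) ∧
      Submodule.span K (Set.range fun i : {i // block i = j} => b i) = (W j).toSubmodule

/-! ### Griffin's rings -/

/-- The elementary symmetric polynomial of degree `r` in the variables `x_i`, `i ∈ A`. -/
def partialEsymm {n : ℕ} (A : Finset (Fin n)) (r : ℕ) : MvPolynomial (Fin n) K :=
  ∑ B ∈ A.powersetCard r, ∏ i ∈ B, X i

/-- `c_t(μ) = μ'_1 + ⋯ + μ'_t - t`, where `μ'` is the conjugate partition. -/
def colExcess (mu : YoungDiagram) (t : ℕ) : ℤ :=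
  ∑ j ∈ Finset.range t, (mu.colLen j : ℤ) - t

/-- The generators of `I_{n,k,μ}`. -/
def griffinGenerators (n k : ℕ) (mu : YoungDiagram) : Set (MvPolynomial (Fin n) K) :=
  {f | ∃ i : Fin n, f = X i ^ k} ∪
  {f | ∃ (A : Finset (Fin n)) (r : ℕ),
    colExcess mu (n - A.card) + ((n : ℤ) - mu.card) < r ∧ r ≤ A.card ∧ f = partialEsymm K A r}

/-- The ideal `I_{n,k,μ}`. -/
def griffinIdeal (n k : ℕ) (mu : YoungDiagram) : Ideal (MvPolynomial (Fin n) K) :=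
  Ideal.span (griffinGenerators K n k mu)

/-- The ring `R_{n,k,μ}`. -/
abbrev GriffinRing (n k : ℕ) (mu : YoungDiagram) : Type _ :=
  MvPolynomial (Fin n) K ⧸ griffinIdeal K n k mu

theorem rename_partialEsymm {n : ℕ} (A : Finset (Fin n)) (r : ℕ) (s : Equiv.Perm (Fin n)) :
    rename s (partialEsymm K A r) = partialEsymm K (A.map s.toEmbedding) r := by
  simp [partialEsymm, Finset.powersetCard_map]

theorem griffinIdeal_le_comap (n k : ℕ) (mu : YoungDiagram) (s : Equiv.Perm (Fin n)) :
    griffinIdeal K n k mu ≤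
      (griffinIdeal K n k mu).comap (rename s : MvPolynomial (Fin n) K →ₐ[K] _) := by
  refine Ideal.span_le.2 ?_
  rintro f (⟨i, rfl⟩ | ⟨A, r, h1, h2, rfl⟩)
  · exact Ideal.subset_span (Or.inl ⟨s i, by simp⟩)
  · refine Ideal.subset_span (Or.inr ⟨A.map s.toEmbedding, r, ?_, ?_, ?_⟩)
    · simpa using h1
    · simpa using h2
    · exact rename_partialEsymm K A r s

/-- The action of the symmetric group on `R_{n,k,μ}`, induced by permuting the variables. -/
def griffinRep (n k : ℕ) (mu : YoungDiagram) :
    Representation K (Equiv.Perm (Fin n)) (GriffinRing K n k mu) where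
  toFun s := (Ideal.quotientMapₐ (griffinIdeal K n k mu) (rename s)
    (griffinIdeal_le_comap K n k mu s)).toLinearMap
  map_one' := by
    refine LinearMap.ext fun x => ?_
    obtain ⟨f, rfl⟩ := Ideal.Quotient.mk_surjective x
    simp
  map_mul' s t := by
    refine LinearMap.ext fun x => ?_
    obtain ⟨f, rfl⟩ := Ideal.Quotient.mk_surjective x
    simp [rename_rename]

end

/-! ### The set `B_{n,k,(n-1)}` -/

/-- The one-row partition `(a)`. -/
def oneRow (a : ℕ) : YoungDiagram := YoungDiagram.ofRowLens [a] (List.sortedGE_iff_pairwise.2 (by simp))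

/-- The two-row partition `(a, b)`. -/
def twoRow (a b : ℕ) (h : b ≤ a) : YoungDiagram :=
  YoungDiagram.ofRowLens [a, b] (List.sortedGE_iff_pairwise.2 (by simp [h]))

/-- Index set for the products `F_T^S e_1^i`: the tableau `S` is semistandard with content `nu`, the
tableau `T` is standard of the same shape (a partition of `n`), and `i < k - des(S)`. -/
structure SpechtIndex (n k : ℕ) (nu : YoungDiagram) where
  /-- The common shape of `S` and `T`. -/
  shape : YoungDiagram
  /-- The semistandard tableau. -/
  S : SemistandardYoungTableau shape
  content_S : HasContent S nu
  /-- The standard tableau. -/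
  T : Tab shape n
  standard_T : T.IsStandard
  /-- The exponent of `e_1`. -/
  i : ℕ
  i_lt : i + des S < k

/-- The polynomial `F_T^S e_1^i`. -/
noncomputable def SpechtIndex.poly (K : Type*) [Field K] {n k : ℕ} {nu : YoungDiagram}
    (a : SpechtIndex n k nu) : MvPolynomial (Fin n) K :=
  higherSpecht K a.S a.T * MvPolynomial.esymm (Fin n) K 1 ^ a.i

end HigherSpecht

/-! ### Semistandard tableaux of content `(n - 1, 1)`, their descents and cocharge labels -/

namespace HigherSpecht

/-! ### One-row and two-row diagrams -/

/-! For `μ = (n - 1)` the condition on `r` reduces to `r ≥ 2`, so the ideal is generated by the `x_i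
^ k` and the products `x_i x_j` with `i ≠ j`. The quotient is the coordinate ring of the union of
the `n` axes, truncated at order `k`: it has basis `1` and `x_i ^ d` for `1 ≤ d < k`. Its degree `0`
part is trivial, and each degree `1 ≤ d < k` carries the permutation representation, which in
characteristic zero is the sum of the trivial module and `V_(n-1,1)`.

On the other side there are only two semistandard tableaux. Shape `(n)` has no descent and all
labels `0`, so `F` is a nonzero constant; shape `(n - 1, 1)` has one descent and the label `1` only
in the top cell, so `F` is a nonzero multiple of `x_b - x_0`, where `b ≠ 0` is the top entry of `T`
and `0` the smallest (`higherSpecht_oneRowTableau`, `higherSpecht_twoRowTableau`). Since `x_i e_1 =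
x_i ^ 2` in the quotient (`mulE_X`), the products with powers of `e_1` are multiples of `e_1 ^ i`
for `i < k` and of `x_b ^ (i + 1) - x_0 ^ (i + 1)` for `i < k - 1`: exactly one trivial block per
degree and one block `V_(n-1,1)` per positive degree.

Independence of the blocks is tested on coefficients along the axes: in a given degree the trivial
block has equal coefficients and the other block has coefficient sum zero
(`eq_zero_of_mulE_mem_blockCompl`, `mulE_mem_blockCompl`). Spanning follows from `n x_b = e_1 + ∑
(x_b - x_c)` (`iSup_map_mulE_eq_top`). -/

theorem mem_oneRow {a : ℕ} {c : ℕ × ℕ} : c ∈ oneRow a ↔ c.1 = 0 ∧ c.2 < a := by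
  rw [oneRow, YoungDiagram.mem_ofRowLens]
  constructor
  · rintro ⟨h, h'⟩
    have h0 : c.1 = 0 := by simpa using h
    simp_all
  · rintro ⟨h, h'⟩
    exact ⟨by simp [h], by simpa [h] using h'⟩

theorem mem_twoRow {a b : ℕ} {h : b ≤ a} {c : ℕ × ℕ} :
    c ∈ twoRow a b h ↔ (c.1 = 0 ∧ c.2 < a) ∨ (c.1 = 1 ∧ c.2 < b) := by
  obtain ⟨i, j⟩ := c
  rw [twoRow, YoungDiagram.mem_ofRowLens]
  constructor
  · rintro ⟨h, h'⟩
    have h0 : i < 2 := by simpa using h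
    interval_cases i <;> simp_all
  · rintro (⟨rfl, h'⟩ | ⟨rfl, h'⟩)
    · exact ⟨by simp, by simpa using h'⟩
    · exact ⟨by simp, by simpa using h'⟩

theorem rowLen_eq_of_forall_mem {lam : YoungDiagram} {i r : ℕ}
    (h : ∀ j, (i, j) ∈ lam ↔ j < r) : lam.rowLen i = r := by
  refine eq_of_forall_lt_iff fun j => ?_
  rw [← YoungDiagram.mem_iff_lt_rowLen, h]

theorem rowLen_twoRow {a b : ℕ} (h : b ≤ a) (i : ℕ) :
    (twoRow a b h).rowLen i = if i = 0 then a else if i = 1 then b else 0 := by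
  refine rowLen_eq_of_forall_mem fun j => ?_
  rw [mem_twoRow]
  split_ifs <;> simp_all

theorem card_oneRow (a : ℕ) : (oneRow a).card = a := by
  have : (oneRow a).cells = (Finset.range a).image fun j => (0, j) := by
    ext ⟨i, j⟩
    simp only [YoungDiagram.mem_cells, mem_oneRow, Finset.mem_image, Finset.mem_range,
      Prod.mk.injEq]
    constructor
    · rintro ⟨rfl, h⟩
      exact ⟨j, h, rfl, rfl⟩
    · rintro ⟨k, h, rfl, rfl⟩
      exact ⟨rfl, h⟩
  rw [YoungDiagram.card, this, Finset.card_image_of_injective _ fun x y h => by simpa using h,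
    Finset.card_range]

theorem card_twoRow_one (a : ℕ) (h : 1 ≤ a) : (twoRow a 1 h).card = a + 1 := by
  have : (twoRow a 1 h).cells = insert (1, 0) (oneRow a).cells := by
    ext ⟨i, j⟩
    simp only [YoungDiagram.mem_cells, mem_oneRow, mem_twoRow, Finset.mem_insert, Prod.mk.injEq]
    omega
  rw [YoungDiagram.card, this, Finset.card_insert_of_notMem, ← YoungDiagram.card, card_oneRow]
  simp [YoungDiagram.mem_cells, mem_oneRow]

/-! ### Tableaux of content `(a, 1)` -/

section Content

variable {lam : YoungDiagram} {a : ℕ}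

/-- Once all entries are `1` or `2` and the `2` is unique, the multiplicity of `1` follows by
counting cells; this is where `hcard` enters. -/
theorem hasContent_twoRow_one_iff (S : SemistandardYoungTableau lam) (ha : 1 ≤ a)
    (hcard : lam.card = a + 1) :
    HasContent S (twoRow a 1 ha) ↔
      (∀ c ∈ lam.cells, S c.1 c.2 = 1 ∨ S c.1 c.2 = 2) ∧
        ∃ q ∈ lam.cells, ∀ c ∈ lam.cells, S c.1 c.2 = 2 ↔ c = q := by
  constructor
  · rintro ⟨h1, h2⟩
    constructor
    · intro c hc
      have hpos := h1 c hc
      by_contra hne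
      have := h2 (S c.1 c.2 - 1)
      rw [rowLen_twoRow, if_neg (by omega), if_neg (by omega), Finset.card_eq_zero] at this
      have hmem : c ∈ (∅ : Finset (ℕ × ℕ)) := this ▸ Finset.mem_filter.2 ⟨hc, by omega⟩
      simp at hmem
    · have := h2 1
      rw [rowLen_twoRow, if_neg (by omega), if_pos rfl, Finset.card_eq_one] at this
      obtain ⟨q, hq⟩ := this
      have hiff : ∀ c, (c ∈ lam.cells ∧ S c.1 c.2 = 2) ↔ c = q := fun c => by
        rw [← @Finset.mem_singleton _ q, ← hq, Finset.mem_filter]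
      exact ⟨q, ((hiff q).2 rfl).1, fun c hc => by rw [← hiff]; simp only [hc, true_and]⟩
  · rintro ⟨h1, q, hq, h2⟩
    have htwo : lam.cells.filter (fun c => S c.1 c.2 = 2) = {q} := by
      ext c
      rw [Finset.mem_filter, Finset.mem_singleton]
      exact ⟨fun h => (h2 c h.1).1 h.2, fun h => ⟨h ▸ hq, (h2 c (h ▸ hq)).2 h⟩⟩
    have hone : lam.cells.filter (fun c => S c.1 c.2 = 1) = lam.cells.erase q := by
      ext c
      rw [Finset.mem_filter, Finset.mem_erase]
      constructor
      · rintro ⟨hc, h⟩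
        exact ⟨fun hcq => by have := (h2 c hc).2 hcq; omega, hc⟩
      · rintro ⟨hcq, hc⟩
        exact ⟨hc, (h1 c hc).resolve_right fun h => hcq ((h2 c hc).1 h)⟩
    refine ⟨fun c hc => by have := h1 c hc; omega, fun i => ?_⟩
    rw [rowLen_twoRow]
    rcases i with _ | _ | i
    · rw [zero_add, hone, Finset.card_erase_of_mem hq, if_pos rfl]
      change lam.card - 1 = a
      omega
    · simp only [zero_add, Nat.reduceAdd]
      rw [htwo]
      simp
    · rw [if_neg (by omega), if_neg (by omega), Finset.card_eq_zero,
        Finset.filter_eq_empty_iff]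
      intro c hc
      have := h1 c hc
      omega

/-- In a tableau of content `(a, 1)`, a cell outside the bottom row carries the letter `2`. -/
theorem HasContent.entry_eq_two {S : SemistandardYoungTableau lam} {ha : 1 ≤ a}
    (hcard : lam.card = a + 1) (hS : HasContent S (twoRow a 1 ha)) {i j : ℕ} (hi : 0 < i)
    (hc : (i, j) ∈ lam) : S i j = 2 := by
  obtain ⟨h1, -⟩ := (hasContent_twoRow_one_iff S ha hcard).1 hS
  have h0 := h1 (0, j) (lam.up_left_mem hi.le le_rfl hc)
  have h2 := h1 (i, j) hc
  have := S.col_strict hi hc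
  simp only at h0 h2
  omega

/-- A tableau of content `(a, 1)` has shape `(a + 1)` or `(a, 1)`. -/
theorem HasContent.shape_eq {S : SemistandardYoungTableau lam} {ha : 1 ≤ a}
    (hcard : lam.card = a + 1) (hS : HasContent S (twoRow a 1 ha)) :
    lam = oneRow (a + 1) ∨ lam = twoRow a 1 ha := by
  have htwo := @HasContent.entry_eq_two _ _ _ _ hcard hS
  obtain ⟨-, q, hq, h2⟩ := (hasContent_twoRow_one_iff S ha hcard).1 hS
  have huniq : ∀ i j, 0 < i → (i, j) ∈ lam → (i, j) = q := fun i j hi hc =>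
    (h2 (i, j) hc).1 (htwo hi hc)
  -- A cell above the bottom row forces `(1, 0)` into the diagram, and both would carry the only
  -- `2`.
  have hupper : ∀ i j, 0 < i → (i, j) ∈ lam → i = 1 ∧ j = 0 := fun i j hi hc => by
    have e1 := huniq i j hi hc
    have e2 := huniq 1 0 one_pos (lam.up_left_mem hi (Nat.zero_le j) hc)
    simpa using e1.trans e2.symm
  by_cases h10 : (1, 0) ∈ lam
  · right
    have hcells : lam.cells = insert (1, 0) (lam.row 0) := by
      ext ⟨i, j⟩
      rw [Finset.mem_insert, YoungDiagram.mem_row_iff, YoungDiagram.mem_cells]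
      constructor
      · intro h
        rcases Nat.eq_zero_or_pos i with rfl | hi
        · exact Or.inr ⟨h, rfl⟩
        · obtain ⟨rfl, rfl⟩ := hupper i j hi h
          exact Or.inl rfl
      · rintro (h | h)
        · exact h ▸ h10
        · exact h.1
    have hlen : lam.rowLen 0 = a := by
      rw [YoungDiagram.card, hcells,
        Finset.card_insert_of_notMem (by simp [YoungDiagram.mem_row_iff]),
        ← YoungDiagram.rowLen_eq_card] at hcard
      omega
    refine YoungDiagram.ext (Finset.ext fun ⟨i, j⟩ => ?_)
    rw [YoungDiagram.mem_cells, YoungDiagram.mem_cells, mem_twoRow]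
    constructor
    · intro h
      rcases Nat.eq_zero_or_pos i with rfl | hi
      · exact Or.inl ⟨rfl, hlen ▸ YoungDiagram.mem_iff_lt_rowLen.1 h⟩
      · obtain ⟨rfl, rfl⟩ := hupper i j hi h
        exact Or.inr ⟨rfl, one_pos⟩
    · rintro (⟨h, h'⟩ | ⟨h, h'⟩)
      · obtain rfl : i = 0 := h
        exact YoungDiagram.mem_iff_lt_rowLen.2 (hlen.symm ▸ h')
      · obtain rfl : i = 1 := h
        obtain rfl : j = 0 := by simpa using h'
        exact h10
  · left
    have hrow : ∀ i j, (i, j) ∈ lam → i = 0 := fun i j hc => by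
      by_contra hi
      obtain ⟨rfl, rfl⟩ := hupper i j (Nat.pos_of_ne_zero hi) hc
      exact h10 hc
    have hcells : lam.cells = lam.row 0 := by
      ext ⟨i, j⟩
      rw [YoungDiagram.mem_row_iff, YoungDiagram.mem_cells]
      exact ⟨fun h => ⟨h, hrow i j h⟩, fun h => h.1⟩
    have hlen : lam.rowLen 0 = a + 1 := by
      rw [← hcard, YoungDiagram.card, hcells, ← YoungDiagram.rowLen_eq_card]
    refine YoungDiagram.ext (Finset.ext fun ⟨i, j⟩ => ?_)
    rw [YoungDiagram.mem_cells, YoungDiagram.mem_cells, mem_oneRow]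
    constructor
    · intro h
      obtain rfl := hrow i j h
      exact ⟨rfl, hlen ▸ YoungDiagram.mem_iff_lt_rowLen.1 h⟩
    · rintro ⟨h, h'⟩
      obtain rfl : i = 0 := h
      exact YoungDiagram.mem_iff_lt_rowLen.2 (hlen.symm ▸ h')

end Content

/-- The entries of the tableau of content `(a, 1)` and shape `(a + 1)`. -/
theorem HasContent.oneRow_apply {a : ℕ} {ha : 1 ≤ a} {S : SemistandardYoungTableau (oneRow (a + 1))}
    (hS : HasContent S (twoRow a 1 ha)) (i j : ℕ) :
    S i j = if i = 0 ∧ j < a + 1 then if j = a then 2 else 1 else 0 := by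
  obtain ⟨h1, ⟨i', j'⟩, hq, h2⟩ := (hasContent_twoRow_one_iff S ha (card_oneRow _)).1 hS
  have hlast : ((0, a) : ℕ × ℕ) ∈ (oneRow (a + 1)).cells := by
    rw [YoungDiagram.mem_cells, mem_oneRow]
    exact ⟨rfl, Nat.lt_succ_self a⟩
  have hq' := hq
  rw [YoungDiagram.mem_cells, mem_oneRow] at hq'
  obtain ⟨hi, hj⟩ := hq'
  simp only at hi hj
  subst hi
  -- Weak increase along the row makes the last entry at least `2`, so the unique `2` is there.
  have hj' : j' = a := by
    have e1 : S 0 j' = 2 := (h2 _ hq).2 rfl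
    have e2 : S 0 j' ≤ S 0 a := S.row_weak_of_le (by omega) hlast
    have e3 := h1 _ hlast
    have e4 := (h2 _ hlast).1 (by simp only at e3 ⊢; omega)
    simpa using e4.symm
  subst hj'
  split_ifs with h h'
  · obtain ⟨rfl, -⟩ := h
    subst h'
    exact (h2 _ hq).2 rfl
  · obtain ⟨rfl, hj⟩ := h
    have hc : ((0, j) : ℕ × ℕ) ∈ (oneRow (j' + 1)).cells := by
      rw [YoungDiagram.mem_cells, mem_oneRow]
      exact ⟨rfl, hj⟩
    exact (h1 _ hc).resolve_right fun e => h' (by simpa using (h2 _ hc).1 e)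
  · exact S.zeros (by rw [mem_oneRow]; exact h)

/-- The entries of the tableau of content and shape `(a, 1)`. -/
theorem HasContent.twoRow_apply {a : ℕ} {ha : 1 ≤ a} {S : SemistandardYoungTableau (twoRow a 1 ha)}
    (hS : HasContent S (twoRow a 1 ha)) (i j : ℕ) :
    S i j = if (i, j) = (1, 0) then 2 else if i = 0 ∧ j < a then 1 else 0 := by
  have hcard := card_twoRow_one a ha
  obtain ⟨h1, q, hq, h2⟩ := (hasContent_twoRow_one_iff S ha hcard).1 hS
  have h10 : ((1, 0) : ℕ × ℕ) ∈ (twoRow a 1 ha) := mem_twoRow.2 (Or.inr ⟨rfl, one_pos⟩)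
  have e : S 1 0 = 2 := hS.entry_eq_two hcard one_pos h10
  obtain rfl := (h2 _ h10).1 e
  split_ifs with h h'
  · rw [Prod.mk.injEq] at h
    rw [h.1, h.2, e]
  · have hc : (i, j) ∈ (twoRow a 1 ha).cells := mem_twoRow.2 (Or.inl h')
    exact (h1 _ hc).resolve_right fun e => h ((h2 _ hc).1 e)
  · refine S.zeros ?_
    rw [mem_twoRow]
    simp only [Prod.mk.injEq] at h ⊢
    omega

/-- The tableau of content `(a, 1)` and shape `(a + 1)`. -/
def oneRowTableau (a : ℕ) : SemistandardYoungTableau (oneRow (a + 1)) where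
  entry i j := if i = 0 ∧ j < a + 1 then if j = a then 2 else 1 else 0
  row_weak' := by
    intro i j1 j2 h hc
    rw [mem_oneRow] at hc
    simp only at hc
    split_ifs <;> omega
  col_strict' := by
    intro i1 i2 j h hc
    rw [mem_oneRow] at hc
    simp only at hc
    omega
  zeros' := by
    intro i j hc
    rw [mem_oneRow] at hc
    exact if_neg hc

/-- The tableau of content and shape `(a, 1)`. -/
def twoRowTableau (a : ℕ) (ha : 1 ≤ a) : SemistandardYoungTableau (twoRow a 1 ha) where
  entry i j := if (i, j) = (1, 0) then 2 else if i = 0 ∧ j < a then 1 else 0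
  row_weak' := by
    intro i j1 j2 h hc
    rw [mem_twoRow] at hc
    simp only [Prod.mk.injEq] at hc ⊢
    split_ifs <;> omega
  col_strict' := by
    intro i1 i2 j h hc
    rw [mem_twoRow] at hc
    simp only [Prod.mk.injEq] at hc ⊢
    split_ifs <;> omega
  zeros' := by
    intro i j hc
    rw [mem_twoRow] at hc
    simp only [Prod.mk.injEq] at hc ⊢
    split_ifs <;> omega

theorem oneRowTableau_apply (a i j : ℕ) :
    oneRowTableau a i j = if i = 0 ∧ j < a + 1 then if j = a then 2 else 1 else 0 := rfl

theorem twoRowTableau_apply (a : ℕ) (ha : 1 ≤ a) (i j : ℕ) :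
    twoRowTableau a ha i j = if (i, j) = (1, 0) then 2 else if i = 0 ∧ j < a then 1 else 0 := rfl

theorem hasContent_oneRowTableau (a : ℕ) (ha : 1 ≤ a) :
    HasContent (oneRowTableau a) (twoRow a 1 ha) := by
  rw [hasContent_twoRow_one_iff _ ha (card_oneRow _)]
  refine ⟨fun ⟨i, j⟩ hc => ?_, (0, a), ?_, fun ⟨i, j⟩ hc => ?_⟩
  · rw [YoungDiagram.mem_cells, mem_oneRow] at hc
    simp only [oneRowTableau_apply, if_pos hc]
    split_ifs <;> simp
  · rw [YoungDiagram.mem_cells, mem_oneRow]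
    exact ⟨rfl, Nat.lt_succ_self a⟩
  · rw [YoungDiagram.mem_cells, mem_oneRow] at hc
    simp only [oneRowTableau_apply, if_pos hc, Prod.mk.injEq]
    split_ifs <;> simp_all

theorem hasContent_twoRowTableau (a : ℕ) (ha : 1 ≤ a) :
    HasContent (twoRowTableau a ha) (twoRow a 1 ha) := by
  rw [hasContent_twoRow_one_iff _ ha (card_twoRow_one a ha)]
  refine ⟨fun ⟨i, j⟩ hc => ?_, (1, 0), ?_, fun ⟨i, j⟩ hc => ?_⟩
  · rw [YoungDiagram.mem_cells, mem_twoRow] at hc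
    simp only [twoRowTableau_apply, Prod.mk.injEq] at hc ⊢
    split_ifs <;> omega
  · rw [YoungDiagram.mem_cells, mem_twoRow]
    exact Or.inr ⟨rfl, one_pos⟩
  · rw [YoungDiagram.mem_cells, mem_twoRow] at hc
    simp only [twoRowTableau_apply, Prod.mk.injEq] at hc ⊢
    split_ifs <;> omega

theorem HasContent.eq_oneRowTableau {a : ℕ} {ha : 1 ≤ a}
    {S : SemistandardYoungTableau (oneRow (a + 1))} (hS : HasContent S (twoRow a 1 ha)) :
    S = oneRowTableau a :=
  SemistandardYoungTableau.ext fun i j => by rw [hS.oneRow_apply, oneRowTableau_apply]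

theorem HasContent.eq_twoRowTableau {a : ℕ} {ha : 1 ≤ a}
    {S : SemistandardYoungTableau (twoRow a 1 ha)} (hS : HasContent S (twoRow a 1 ha)) :
    S = twoRowTableau a ha :=
  SemistandardYoungTableau.ext fun i j => by rw [hS.twoRow_apply, twoRowTableau_apply]

/-! ### Descents and cocharge labels -/

theorem des_oneRowTableau (a : ℕ) : des (oneRowTableau a) = 0 := by
  rw [des, Finset.card_eq_zero, Finset.filter_eq_empty_iff]
  rintro v - ⟨c, hc, d, hd, -, -, h⟩
  rw [YoungDiagram.mem_cells, mem_oneRow] at hc hd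
  omega

theorem des_twoRowTableau (a : ℕ) (ha : 1 ≤ a) : des (twoRowTableau a ha) = 1 := by
  rw [des, Finset.card_eq_one]
  refine ⟨1, Finset.ext fun v => ?_⟩
  rw [Finset.mem_filter, Finset.mem_singleton]
  constructor
  · rintro ⟨-, ⟨i, j⟩, hc, ⟨i', j'⟩, hd, h1, h2, h⟩
    rw [YoungDiagram.mem_cells, mem_twoRow] at hc hd
    simp only [twoRowTableau_apply, Prod.mk.injEq] at hc hd h1 h2 h
    split_ifs at h1 h2 <;> omega
  · rintro rfl
    have h00 : ((0, 0) : ℕ × ℕ) ∈ (twoRow a 1 ha).cells := mem_twoRow.2 (Or.inl ⟨rfl, ha⟩)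
    have h10 : ((1, 0) : ℕ × ℕ) ∈ (twoRow a 1 ha).cells := mem_twoRow.2 (Or.inr ⟨rfl, one_pos⟩)
    have e0 : twoRowTableau a ha 0 0 = 1 := by
      rw [twoRowTableau_apply, if_neg (by simp), if_pos ⟨rfl, ha⟩]
    have e1 : twoRowTableau a ha 1 0 = 2 := by rw [twoRowTableau_apply, if_pos rfl]
    exact ⟨Finset.mem_image.2 ⟨_, h00, e0⟩, _, h00, _, h10, e0, e1, one_pos⟩

section Words

variable {P : Type*} [LinearOrder P]

/-- Whichever standard subword a `1` falls into, it starts that subword. The default value `0` when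
the rounds run out agrees with this. -/
theorem cochargeLabelAux_eq_zero (w : P → ℕ) {p : P} (hp : w p = 1) (m : ℕ) (A : Finset P) :
    cochargeLabelAux w m A p = 0 := by
  induction m generalizing A with
  | zero => rfl
  | succ m ih =>
    rw [cochargeLabelAux, hp, ih]
    split_ifs <;> rfl

theorem rightmost_eq_of_unique {w : P → ℕ} {A : Finset P} {v : ℕ} {p : P}
    (h : A.filter (fun q => w q = v) = {p}) : rightmost w A v = p := by
  rw [rightmost, h, Finset.max_singleton]

/-- Both branches of the cyclic search can only end at the single occurrence of `v`. -/
theorem cprev_eq_of_unique {w : P → ℕ} {A : Finset P} {v : ℕ} {p : P}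
    (h : A.filter (fun q => w q = v) = {p}) (r : WithBot P) : cprev w A v r = p := by
  have hmem : ∀ q, (q ∈ A ∧ w q = v) ↔ q = p := fun q => by
    rw [← @Finset.mem_singleton _ p, ← h, Finset.mem_filter]
  rw [cprev]
  split_ifs with hr
  · refine rightmost_eq_of_unique (Finset.ext fun q => ?_)
    obtain ⟨q', hq', hw, hlt⟩ := hr
    obtain rfl := (hmem q').1 ⟨hq', hw⟩
    rw [Finset.mem_filter, Finset.mem_filter, Finset.mem_singleton, ← hmem q]
    constructor
    · rintro ⟨⟨h1, -⟩, h2⟩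
      exact ⟨h1, h2⟩
    · rintro ⟨h1, h2⟩
      obtain rfl := (hmem q).1 ⟨h1, h2⟩
      exact ⟨⟨h1, hlt⟩, h2⟩
  · exact rightmost_eq_of_unique h

open Classical in
/-- The label of the only letter `2` of a word. -/
theorem cochargeLabel_of_unique {w : P → ℕ} {A : Finset P} {p : P}
    (h : A.filter (fun q => w q = 2) = {p}) :
    cochargeLabel w A p = if ∃ q ∈ A, w q = 1 ∧ p < q then 1 else 0 := by
  have hp : p ∈ A ∧ w p = 2 := by
    rw [← Finset.mem_filter (p := fun q => w q = 2), h, Finset.mem_singleton]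
  obtain ⟨m, hm⟩ : ∃ m, A.card = m + 1 :=
    Nat.exists_eq_succ_of_ne_zero (Finset.card_ne_zero_of_mem hp.1)
  have hpos : subwordPos w A 1 = p := cprev_eq_of_unique h _
  have hmem : p ∈ firstSubword w A := by
    rw [firstSubword, Finset.mem_filter, hp.2]
    exact ⟨hp.1, hpos⟩
  rw [cochargeLabel, hm, cochargeLabelAux, if_pos hmem, hp.2]
  -- The `2` is compared with the rightmost `1`; being to the left of it is the same as being to the
  -- left of some `1`.
  change 0 + (if subwordPos w A 1 < rightmost w A 1 then 1 else 0) = _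
  rw [hpos, zero_add]
  refine if_congr ?_ rfl rfl
  rw [rightmost, Finset.max_eq_sup_withBot, Finset.lt_sup_iff]
  simp only [Finset.mem_filter, WithBot.coe_lt_coe, and_assoc]

end Words

theorem readingPos_lt_iff {c d : ℕ × ℕ} :
    readingPos c < readingPos d ↔ d.1 < c.1 ∨ c.1 = d.1 ∧ c.2 < d.2 := by
  rw [readingPos, readingPos, Prod.Lex.toLex_lt_toLex]
  rfl

theorem cw_eq_zero_of_eq_one {lam : YoungDiagram} (S : SemistandardYoungTableau lam) {c : ℕ × ℕ}
    (h : S c.1 c.2 = 1) : cw S c = 0 :=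
  cochargeLabelAux_eq_zero (p := readingPos c) _ h _ _

open Classical in
theorem cw_of_unique {lam : YoungDiagram} (S : SemistandardYoungTableau lam) {c : ℕ × ℕ}
    (hc : c ∈ lam) (h : ∀ d ∈ lam, S d.1 d.2 = 2 ↔ d = c) :
    cw S c = if ∃ d ∈ lam, S d.1 d.2 = 1 ∧ (d.1 < c.1 ∨ c.1 = d.1 ∧ c.2 < d.2) then 1 else 0 := by
  rw [cw, cochargeLabel_of_unique]
  · refine if_congr ?_ rfl rfl
    simp only [Finset.mem_image, exists_exists_and_eq_and, readingPos_lt_iff]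
    rfl
  · ext p
    simp only [Finset.mem_filter, Finset.mem_image, Finset.mem_singleton]
    constructor
    · rintro ⟨⟨d, hd, rfl⟩, h2⟩
      rw [(h d hd).1 h2]
    · rintro rfl
      exact ⟨⟨c, hc, rfl⟩, (h c hc).2 rfl⟩

/-- The `2` is the last letter read, so no `1` lies to its right. -/
theorem cw_oneRowTableau (a : ℕ) {c : ℕ × ℕ} (hc : c ∈ oneRow (a + 1)) :
    cw (oneRowTableau a) c = 0 := by
  classical
  obtain ⟨i, j⟩ := c
  obtain ⟨hi, hj⟩ := mem_oneRow.1 hc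
  simp only at hi hj
  subst hi
  by_cases hja : j = a
  · rw [cw_of_unique _ hc, if_neg]
    · rintro ⟨d, hd, -, h⟩
      rw [mem_oneRow] at hd
      simp only at h
      omega
    · rintro ⟨i', j'⟩ hd
      rw [mem_oneRow] at hd
      simp only [oneRowTableau_apply, if_pos hd, Prod.mk.injEq]
      split_ifs <;> simp_all
  · refine cw_eq_zero_of_eq_one _ ?_
    rw [oneRowTableau_apply, if_pos ⟨rfl, hj⟩, if_neg hja]

/-- The `2` sits in the top row and is read before every `1`. -/
theorem cw_twoRowTableau (a : ℕ) (ha : 1 ≤ a) {c : ℕ × ℕ} (hc : c ∈ twoRow a 1 ha) :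
    cw (twoRowTableau a ha) c = if c = (1, 0) then 1 else 0 := by
  classical
  split_ifs with h
  · subst h
    rw [cw_of_unique _ hc, if_pos]
    · refine ⟨(0, 0), mem_twoRow.2 (Or.inl ⟨rfl, ha⟩), ?_, Or.inl one_pos⟩
      rw [twoRowTableau_apply, if_neg (by simp), if_pos ⟨rfl, ha⟩]
    · rintro ⟨i, j⟩ hd
      rw [mem_twoRow] at hd
      simp only [twoRowTableau_apply, Prod.mk.injEq] at hd ⊢
      split_ifs <;> omega
  · refine cw_eq_zero_of_eq_one _ ?_
    rw [mem_twoRow] at hc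
    rw [twoRowTableau_apply, if_neg h, if_pos]
    rcases hc with hc | hc
    · exact hc
    · exact absurd (Prod.ext hc.1 (by simpa using hc.2)) h

end HigherSpecht

/-! ### Standard tableaux and explicit higher Specht polynomials for the two shapes -/

namespace HigherSpecht

open MvPolynomial

/-! ### Standard tableaux of shapes `(n)` and `(n - 1, 1)` -/

/-- The cells of a one-row diagram, from left to right. -/
def oneRowCells (n : ℕ) : Fin n ≃ {c : ℕ × ℕ // c ∈ (oneRow n).cells} where
  toFun j := ⟨(0, j), mem_oneRow.2 ⟨rfl, j.2⟩⟩
  invFun c := ⟨c.1.2, (mem_oneRow.1 c.2).2⟩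
  left_inv _ := rfl
  right_inv c := Subtype.ext (Prod.ext (mem_oneRow.1 c.2).1.symm rfl)

/-- The cells of the diagram `(a, 1)`: the top cell and the cells of the bottom row, from left to
right. -/
def twoRowCells (a : ℕ) (ha : 1 ≤ a) :
    Option (Fin a) ≃ {c : ℕ × ℕ // c ∈ (twoRow a 1 ha).cells} where
  toFun o := o.elim ⟨(1, 0), mem_twoRow.2 (Or.inr ⟨rfl, one_pos⟩)⟩
    fun j => ⟨(0, j), mem_twoRow.2 (Or.inl ⟨rfl, j.2⟩)⟩
  invFun c := if h : c.1.1 = 0 then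
      some ⟨c.1.2, ((mem_twoRow.1 c.2).resolve_right fun h' => by omega).2⟩
    else none
  left_inv o := by cases o <;> simp
  right_inv c := by
    obtain ⟨⟨i, j⟩, hc⟩ := c
    rw [YoungDiagram.mem_cells, mem_twoRow] at hc
    simp only at hc
    by_cases h : i = 0
    · subst h
      simp
    · simp only [h, dite_false, Option.elim_none, Subtype.mk.injEq, Prod.mk.injEq]
      omega

theorem coe_twoRowCells_none (a : ℕ) (ha : 1 ≤ a) : (twoRowCells a ha none).1 = (1, 0) := rfl

theorem coe_twoRowCells_some (a : ℕ) (ha : 1 ≤ a) (j : Fin a) :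
    (twoRowCells a ha (some j)).1 = (0, j.1) := rfl

theorem isStandard_oneRowCells_symm (n : ℕ) :
    Tab.IsStandard ((oneRowCells n).symm : Tab (oneRow n) n) := by
  refine ⟨fun c d _ h => h, fun c d _ h => ?_⟩
  have := (mem_oneRow.1 d.2).1
  omega

/-- A strictly monotone map on `Fin n` is determined by its range. -/
theorem Tab.IsStandard.eq_oneRowCells_symm {n : ℕ} {T : Tab (oneRow n) n} (hT : T.IsStandard) :
    T = (oneRowCells n).symm := by
  have hmono : StrictMono fun j => T (oneRowCells n j) := fun j j' h => hT.1 _ _ rfl h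
  have hrange : Set.range (fun j => T (oneRowCells n j)) = Set.range (id : Fin n → Fin n) := by
    rw [Set.range_id]
    exact ((oneRowCells n).trans T).surjective.range_eq
  have := (hmono.range_inj strictMono_id).1 hrange
  refine Equiv.ext fun c => ?_
  simpa using congrFun this ((oneRowCells n).symm c)

/-- The filling of `(m + 1, 1)` with `b` in the top cell and increasing bottom row. -/
def hookTab {m : ℕ} (h : 1 ≤ m + 1) (b : Fin (m + 2)) : Tab (twoRow (m + 1) 1 h) (m + 2) :=
  (twoRowCells (m + 1) h).symm.trans (finSuccEquiv' b).symm

section Hook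

variable {m : ℕ} {h : 1 ≤ m + 1}

theorem hookTab_top (b : Fin (m + 2)) : hookTab h b (twoRowCells (m + 1) h none) = b := by
  simp [hookTab]

theorem hookTab_bottom (b : Fin (m + 2)) (j : Fin (m + 1)) :
    hookTab h b (twoRowCells (m + 1) h (some j)) = b.succAbove j := by
  simp [hookTab]

/-- Only the first column has two cells. If `b ≠ 0`, the bottom row starts with `0`, which lies
below `b`. -/
theorem isStandard_hookTab {b : Fin (m + 2)} (hb : b ≠ 0) : (hookTab h b).IsStandard := by
  constructor
  · intro c d
    obtain ⟨c, rfl⟩ := (twoRowCells (m + 1) h).surjective c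
    obtain ⟨d, rfl⟩ := (twoRowCells (m + 1) h).surjective d
    rcases c with _ | c <;> rcases d with _ | d <;>
      simp only [coe_twoRowCells_none, coe_twoRowCells_some, hookTab_top, hookTab_bottom]
    · omega
    · omega
    · omega
    · intro _ hcd
      exact b.strictMono_succAbove hcd
  · intro c d
    obtain ⟨c, rfl⟩ := (twoRowCells (m + 1) h).surjective c
    obtain ⟨d, rfl⟩ := (twoRowCells (m + 1) h).surjective d
    rcases c with _ | c <;> rcases d with _ | d <;>
      simp only [coe_twoRowCells_none, coe_twoRowCells_some, hookTab_top, hookTab_bottom]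
    · omega
    · omega
    · intro hc _
      obtain rfl : c = 0 := Fin.ext hc
      rw [Fin.succAbove_ne_zero_zero hb]
      exact Fin.pos_of_ne_zero hb
    · omega

theorem Tab.IsStandard.top_ne_zero {T : Tab (twoRow (m + 1) 1 h) (m + 2)} (hT : T.IsStandard) :
    T (twoRowCells (m + 1) h none) ≠ 0 :=
  Fin.ne_zero_of_lt (hT.2 (twoRowCells (m + 1) h (some 0)) _ rfl one_pos)

/-- The bottom row is the increasing enumeration of the complement of the top entry. -/
theorem Tab.IsStandard.eq_hookTab {T : Tab (twoRow (m + 1) 1 h) (m + 2)} (hT : T.IsStandard) :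
    T = hookTab h (T (twoRowCells (m + 1) h none)) := by
  set b := T (twoRowCells (m + 1) h none) with hb
  have hmono : StrictMono fun j => T (twoRowCells (m + 1) h (some j)) :=
    fun j j' hj => hT.1 _ _ rfl hj
  have hrange : Set.range (fun j => T (twoRowCells (m + 1) h (some j))) =
      Set.range b.succAbove := by
    rw [Fin.range_succAbove]
    ext x
    rw [Set.mem_compl_iff, Set.mem_singleton_iff]
    constructor
    · rintro ⟨j, rfl⟩ hx
      simpa using ((twoRowCells (m + 1) h).trans T).injective hx
    · intro hx
      obtain ⟨o, rfl⟩ := ((twoRowCells (m + 1) h).trans T).surjective x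
      rcases o with _ | j
      · exact absurd rfl hx
      · exact ⟨j, rfl⟩
  have hfun := (hmono.range_inj b.strictMono_succAbove).1 hrange
  refine Equiv.ext fun c => ?_
  obtain ⟨o, rfl⟩ := (twoRowCells (m + 1) h).surjective c
  rcases o with _ | j
  · rw [hookTab_top]
  · rw [hookTab_bottom]
    exact congrFun hfun j

end Hook

/-! ### Specht polynomials and higher Specht polynomials of these shapes -/

theorem Tab.card_rowPerms_ne_zero {lam : YoungDiagram} {n : ℕ} (T : Tab lam n) :
    T.rowPerms.card ≠ 0 :=
  Finset.card_ne_zero_of_mem (a := 1) (by simp [Tab.rowPerms])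

section OneRow

variable (K : Type*) [Field K] {a : ℕ}

theorem spechtPoly_oneRow (T : Tab (oneRow a) a) : spechtPoly K T = 1 := by
  rw [spechtPoly, Finset.filter_eq_empty_iff.2, Finset.prod_empty]
  rintro ⟨c, d⟩ - ⟨-, h⟩
  exact absurd (mem_oneRow.1 d.2).1 (Nat.ne_zero_of_lt h)

theorem colPerms_oneRow (T : Tab (oneRow a) a) : T.colPerms = {1} := by
  ext s
  rw [Tab.colPerms, Finset.mem_filter, Finset.mem_singleton]
  constructor
  · rintro ⟨-, hs⟩
    refine Equiv.ext fun x => T.symm.injective (Subtype.ext (Prod.ext ?_ (hs x)))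
    rw [(mem_oneRow.1 (T.symm (s x)).2).1, (mem_oneRow.1 (T.symm ((1 : Equiv.Perm (Fin a)) x)).2).1]
  · rintro rfl
    exact ⟨Finset.mem_univ _, fun _ => rfl⟩

theorem higherSpecht_oneRowTableau (T : Tab (oneRow (a + 1)) (a + 1)) :
    higherSpecht K (oneRowTableau a) T = (T.rowPerms.card : K) • 1 := by
  have hprod : (∏ c, X (T c) ^ cw (oneRowTableau a) c.1 : MvPolynomial (Fin (a + 1)) K) = 1 :=
    Finset.prod_eq_one fun c _ => by rw [cw_oneRowTableau a c.2, pow_zero]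
  rw [higherSpecht, hprod, colPerms_oneRow]
  simp [smul_eq_C_mul]

end OneRow

section TwoRow

variable (K : Type*) [Field K] {a : ℕ} {ha : 1 ≤ a} {n : ℕ}

theorem eq_or_eq_of_snd_twoRowCells_eq [NeZero a] {o o' : Option (Fin a)}
    (h : (twoRowCells a ha o).1.2 = (twoRowCells a ha o').1.2) :
    o = o' ∨ (o = none ∧ o' = some 0) ∨ (o = some 0 ∧ o' = none) := by
  rcases o with _ | j <;> rcases o' with _ | j'
  · exact Or.inl rfl
  · exact Or.inr (Or.inl ⟨rfl, congrArg some (Fin.ext h.symm)⟩)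
  · exact Or.inr (Or.inr ⟨congrArg some (Fin.ext h), rfl⟩)
  · exact Or.inl (congrArg some (Fin.ext h))

theorem spechtPoly_twoRow [NeZero a] (T : Tab (twoRow a 1 ha) n) :
    spechtPoly K T = X (T (twoRowCells a ha none)) - X (T (twoRowCells a ha (some 0))) := by
  have : (Finset.univ.filter fun p : {c : ℕ × ℕ // c ∈ (twoRow a 1 ha).cells} ×
      {c : ℕ × ℕ // c ∈ (twoRow a 1 ha).cells} => p.1.1.2 = p.2.1.2 ∧ p.1.1.1 < p.2.1.1) =
      {(twoRowCells a ha (some 0), twoRowCells a ha none)} := by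
    ext ⟨c, d⟩
    rw [Finset.mem_filter, Finset.mem_singleton]
    obtain ⟨c, rfl⟩ := (twoRowCells a ha).surjective c
    obtain ⟨d, rfl⟩ := (twoRowCells a ha).surjective d
    rw [Prod.mk.injEq, (twoRowCells a ha).apply_eq_iff_eq, (twoRowCells a ha).apply_eq_iff_eq]
    constructor
    · rintro ⟨-, h1, h2⟩
      rcases eq_or_eq_of_snd_twoRowCells_eq h1 with rfl | ⟨rfl, rfl⟩ | h
      · exact absurd h2 (lt_irrefl _)
      · exact absurd h2 (Nat.not_lt_zero _)
      · exact h
    · rintro ⟨rfl, rfl⟩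
      exact ⟨Finset.mem_univ _, rfl, one_pos⟩
  rw [spechtPoly, this, Finset.prod_singleton]

theorem apply_top_of_mem_rowPerms {T : Tab (twoRow a 1 ha) n} {s : Equiv.Perm (Fin n)}
    (hs : s ∈ T.rowPerms) : s (T (twoRowCells a ha none)) = T (twoRowCells a ha none) := by
  rw [Tab.rowPerms, Finset.mem_filter] at hs
  have h1 := hs.2 (T (twoRowCells a ha none))
  rw [Equiv.symm_apply_apply, coe_twoRowCells_none] at h1
  obtain ⟨o, ho⟩ := ((twoRowCells a ha).trans T).surjective (s (T (twoRowCells a ha none)))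
  rw [Equiv.trans_apply] at ho
  rw [← ho, Equiv.symm_apply_apply] at h1
  rcases o with _ | j
  · exact ho.symm
  · rw [coe_twoRowCells_some] at h1
    simp at h1

theorem colPerms_twoRow [NeZero a] (T : Tab (twoRow a 1 ha) n) :
    T.colPerms =
      {1, Equiv.swap (T (twoRowCells a ha none)) (T (twoRowCells a ha (some 0)))} := by
  set e := (twoRowCells a ha).trans T with he
  have hT : ∀ o, T.symm (e o) = twoRowCells a ha o := fun o => T.symm_apply_apply _
  have hcol : ∀ s, s ∈ T.colPerms ↔
      ∀ o, (T.symm (s (e o))).1.2 = (twoRowCells a ha o).1.2 := fun s => by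
    rw [Tab.colPerms, Finset.mem_filter, ← e.forall_congr_right]
    simp only [Finset.mem_univ, true_and, hT]
  change _ = ({1, Equiv.swap (e none) (e (some 0))} : Finset (Equiv.Perm (Fin n)))
  ext s
  rw [Finset.mem_insert, Finset.mem_singleton, hcol]
  constructor
  · intro hs
    have hs' : ∀ o, s (e o) = e o ∨ (s (e o) = e none ∧ o = some 0) ∨
        (s (e o) = e (some 0) ∧ o = none) := fun o => by
      obtain ⟨o', ho'⟩ := e.surjective (s (e o))
      have := hs o
      rw [← ho', hT] at this
      rw [← ho', e.apply_eq_iff_eq, e.apply_eq_iff_eq, e.apply_eq_iff_eq]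
      exact eq_or_eq_of_snd_twoRowCells_eq this
    have hfix : ∀ j, j ≠ 0 → s (e (some j)) = e (some j) := fun j hj => by
      simpa [hj] using hs' (some j)
    rcases hs' none with h | h | h
    · left
      refine Equiv.ext fun x => ?_
      obtain ⟨o, rfl⟩ := e.surjective x
      rcases o with _ | j
      · exact h
      · by_cases hj : j = 0
        · subst hj
          rcases hs' (some 0) with h' | h' | h'
          · exact h'
          · exact absurd (e.injective (s.injective (h.trans h'.1.symm))) (by simp)
          · exact absurd h'.2 (by simp)
        · exact hfix j hj
    · exact absurd h.2 (by simp)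
    · right
      refine Equiv.ext fun x => ?_
      obtain ⟨o, rfl⟩ := e.surjective x
      rcases o with _ | j
      · rw [h.1, Equiv.swap_apply_left]
      · by_cases hj : j = 0
        · subst hj
          rw [Equiv.swap_apply_right]
          rcases hs' (some 0) with h' | h' | h'
          · exact absurd (e.injective (s.injective (h.1.trans h'.symm))) (by simp)
          · exact h'.1
          · exact absurd h'.2 (by simp)
        · rw [hfix j hj, Equiv.swap_apply_of_ne_of_ne]
          · exact fun h => absurd (e.injective h) (by simp)
          · exact fun h => hj (by simpa using e.injective h)
  · rintro (rfl | rfl) o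
    · rw [Equiv.Perm.one_apply, hT]
    · rcases o with _ | j
      · rw [Equiv.swap_apply_left, hT]
        rfl
      · by_cases hj : j = 0
        · subst hj
          rw [Equiv.swap_apply_right, hT]
          rfl
        · rw [Equiv.swap_apply_of_ne_of_ne, hT]
          · exact fun h => absurd (e.injective h) (by simp)
          · exact fun h => hj (by simpa using e.injective h)

/-- The cocharge monomial is the variable of the top cell. Row permutations fix it, since the top
row has one cell, and contribute the factor `|R(T)|`; the only nontrivial column permutation is the
swap in the first column, which yields the difference. -/
theorem higherSpecht_twoRowTableau [NeZero a] (T : Tab (twoRow a 1 ha) n) :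
    higherSpecht K (twoRowTableau a ha) T = (T.rowPerms.card : K) •
      (X (T (twoRowCells a ha none)) - X (T (twoRowCells a ha (some 0)))) := by
  have hne : T (twoRowCells a ha none) ≠ T (twoRowCells a ha (some 0)) := fun h => by
    simpa using ((twoRowCells a ha).trans T).injective h
  have hprod : (∏ c, X (T c) ^ cw (twoRowTableau a ha) c.1 : MvPolynomial (Fin n) K) =
      X (T (twoRowCells a ha none)) := by
    rw [Finset.prod_eq_single (twoRowCells a ha none)]
    · rw [cw_twoRowTableau a ha (twoRowCells a ha none).2,
        if_pos (coe_twoRowCells_none a ha), pow_one]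
    · intro c _ hc
      have hc' : c.1 ≠ (1, 0) := fun h => hc (Subtype.ext h)
      rw [cw_twoRowTableau a ha c.2, if_neg hc', pow_zero]
    · exact fun h => absurd (Finset.mem_univ _) h
  have hinner : ∀ t : Equiv.Perm (Fin n), (∑ s ∈ T.rowPerms, ((Equiv.Perm.sign t : ℤˣ) : ℤ) •
      rename (t * s) (X (T (twoRowCells a ha none)) : MvPolynomial (Fin n) K)) =
      (T.rowPerms.card : K) • (((Equiv.Perm.sign t : ℤˣ) : ℤ) •
        X (t (T (twoRowCells a ha none)))) := fun t => by
    rw [Nat.cast_smul_eq_nsmul, ← Finset.sum_const]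
    refine Finset.sum_congr rfl fun s hs => ?_
    rw [rename_X, Equiv.Perm.mul_apply, apply_top_of_mem_rowPerms hs]
  rw [higherSpecht, hprod, Finset.sum_congr rfl fun t _ => hinner t, colPerms_twoRow,
    Finset.sum_pair, ← smul_add]
  · rw [Equiv.Perm.sign_one, Equiv.Perm.sign_swap hne, Equiv.swap_apply_left]
    simp [sub_eq_add_neg]
  · intro h
    exact hne (by simpa using congrArg (fun s => s (T (twoRowCells a ha (some 0)))) h.symm)

end TwoRow

end HigherSpecht

/-! ### The ring as functions on the coordinate axes, the two Specht modules and the index set -/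

namespace HigherSpecht

open MvPolynomial

/-! ### Images of subrepresentations and families indexed by blocks -/

section Blocks

variable {K G V M : Type*} [Field K] [Monoid G] [AddCommGroup V] [Module K V] [AddCommGroup M]
  [Module K M] {ρ : Representation K G V} {σ : Representation K G M}

/-- The image of a subrepresentation under an equivariant linear map. -/
def mapSubrep (φ : V →ₗ[K] M) (hφ : ∀ g v, φ (ρ g v) = σ g (φ v)) (U : Subrepresentation ρ) :
    Subrepresentation σ where
  toSubmodule := U.toSubmodule.map φ
  apply_mem_toSubmodule g := by
    rintro _ ⟨v, hv, rfl⟩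
    exact ⟨ρ g v, U.apply_mem_toSubmodule g hv, hφ g v⟩

theorem nonempty_equiv_mapSubrep (φ : V →ₗ[K] M) (hφ : ∀ g v, φ (ρ g v) = σ g (φ v))
    (U : Subrepresentation ρ) (hU : Disjoint U.toSubmodule (LinearMap.ker φ)) :
    Nonempty ((mapSubrep φ hφ U).toRepresentation.Equiv U.toRepresentation) := by
  have hinj : Function.Injective (φ.submoduleMap U.toSubmodule) := by
    rw [← LinearMap.ker_eq_bot, LinearMap.ker_eq_bot']
    intro v hv
    exact Subtype.ext (Submodule.disjoint_def.1 hU v v.2 (congrArg Subtype.val hv))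
  let e := LinearEquiv.ofBijective (φ.submoduleMap U.toSubmodule)
    ⟨hinj, φ.submoduleMap_surjective U.toSubmodule⟩
  refine ⟨(Representation.Equiv.mk (σ := (mapSubrep φ hφ U).toRepresentation) e
    fun g => LinearMap.ext fun v => Subtype.ext ?_).symm⟩
  exact hφ g v

/-- Reduces independence to exhibiting, for each block, linear conditions `Z j` that all other
blocks satisfy and that no nonzero vector of the block itself satisfies. -/
theorem iSupIndep_of_disjoint {ι : Type*} {W Z : ι → Submodule K M}
    (h0 : ∀ j l, l ≠ j → W l ≤ Z j) (h1 : ∀ j, Disjoint (W j) (Z j)) : iSupIndep W :=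
  fun j => (h1 j).mono_right (iSup₂_le fun l hl => h0 j l hl)

end Blocks

/-- The block map is the first component of the sigma type; its fibres are identified with the types
`B j`, so that the conditions can be checked on these. -/
theorem isHigherSpechtBasis_of_sigma {K : Type*} [Field K] {n : ℕ} {M : Type*} [AddCommGroup M]
    [Module K M] {ρ : Representation K (Equiv.Perm (Fin n)) M} {ι : Type*} {b : ι → M}
    {J : Type} [Finite J] {B : J → Type} (e : (Σ j, B j) ≃ ι) (shape : J → YoungDiagram)
    (W : J → Subrepresentation ρ) (hcard : ∀ j, (shape j).card = n)
    (hequiv : ∀ j, Nonempty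
      ((W j).toRepresentation.Equiv (spechtModule K n (shape j)).toRepresentation))
    (hindep : iSupIndep fun j => (W j).toSubmodule) (htop : ⨆ j, (W j).toSubmodule = ⊤)
    (hli : ∀ j, LinearIndependent K fun x : B j => b (e ⟨j, x⟩))
    (hspan : ∀ j, Submodule.span K (Set.range fun x : B j => b (e ⟨j, x⟩)) =
      (W j).toSubmodule) :
    IsHigherSpechtBasis ρ b := by
  refine ⟨J, inferInstance, shape, W, fun i => (e.symm i).1, hcard, hequiv, hindep, htop,
    fun j => ?_⟩
  let f : B j ≃ {i // (e.symm i).1 = j} :=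
    (Equiv.sigmaSubtype j).symm.trans (e.subtypeEquiv fun s => by simp)
  have hf : (fun x : B j => b (e ⟨j, x⟩)) =
      (fun i : {i // (e.symm i).1 = j} => b i) ∘ f := rfl
  have h1 := hli j
  have h2 := hspan j
  rw [hf] at h1 h2
  rw [f.surjective.range_comp] at h2
  exact ⟨(linearIndependent_equiv f).1 h1, h2⟩

/-! ### The ideal for the one-row partition `(n - 1)` -/

theorem colLen_oneRow (a j : ℕ) : (oneRow a).colLen j = if j < a then 1 else 0 := by
  refine eq_of_forall_lt_iff fun i => ?_
  rw [← YoungDiagram.mem_iff_lt_colLen, mem_oneRow]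
  simp only
  split_ifs <;> omega

theorem colExcess_oneRow_of_le {a t : ℕ} (h : t ≤ a) : colExcess (oneRow a) t = 0 := by
  rw [colExcess, Finset.sum_congr rfl fun j hj => by
    rw [colLen_oneRow, if_pos (by have := Finset.mem_range.1 hj; omega)]]
  simp

theorem colExcess_oneRow_succ (a : ℕ) : colExcess (oneRow a) (a + 1) = -1 := by
  have h := colExcess_oneRow_of_le (le_refl a)
  rw [colExcess] at h ⊢
  rw [Finset.sum_range_succ, colLen_oneRow, if_neg (lt_irrefl a)]
  push_cast
  linarith

/-- For nonempty `A` the excess is `0` and the bound reads `1 < r`. For empty `A` the excess drops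
to `-1`, but `r ≤ 0` makes both sides false. -/
theorem griffin_bound_oneRow_iff {a r : ℕ} {A : Finset (Fin (a + 1))} (hr : r ≤ A.card) :
    colExcess (oneRow a) (a + 1 - A.card) + (((a + 1 : ℕ) : ℤ) - (oneRow a).card) < r ↔
      2 ≤ r := by
  rw [card_oneRow]
  rcases Nat.eq_zero_or_pos A.card with h | h
  · rw [h, Nat.sub_zero, colExcess_oneRow_succ]
    push_cast
    omega
  · rw [colExcess_oneRow_of_le (by omega)]
    push_cast
    omega

section Ring

variable {K : Type*} [Field K] {a k : ℕ}

theorem X_pow_mem_griffinIdeal {n k : ℕ} {mu : YoungDiagram} (i : Fin n) :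
    (X i ^ k : MvPolynomial (Fin n) K) ∈ griffinIdeal K n k mu :=
  Ideal.subset_span (Or.inl ⟨i, rfl⟩)

theorem X_mul_X_mem_griffinIdeal {i j : Fin (a + 1)} (hij : i ≠ j) :
    (X i * X j : MvPolynomial (Fin (a + 1)) K) ∈ griffinIdeal K (a + 1) k (oneRow a) := by
  have hcard : ({i, j} : Finset (Fin (a + 1))).card = 2 := Finset.card_pair hij
  refine Ideal.subset_span (Or.inr ⟨{i, j}, 2, ?_, hcard.ge, ?_⟩)
  · exact (griffin_bound_oneRow_iff hcard.ge).2 le_rfl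
  · have := Finset.powersetCard_self ({i, j} : Finset (Fin (a + 1)))
    rw [hcard] at this
    rw [partialEsymm, this, Finset.sum_singleton, Finset.prod_pair hij]

/-- Restriction of a polynomial to the `i`-th coordinate axis. -/
noncomputable def axis (K : Type*) [Field K] {n : ℕ} (i : Fin n) :
    MvPolynomial (Fin n) K →ₐ[K] Polynomial K :=
  aeval (Pi.single i Polynomial.X)

theorem axis_X {n : ℕ} (i j : Fin n) :
    axis K i (X j) = if j = i then Polynomial.X else 0 := by
  rw [axis, aeval_X, Pi.single_apply]

theorem axis_esymm_one {n : ℕ} (i : Fin n) : axis K i (esymm (Fin n) K 1) = Polynomial.X := by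
  simp [esymm_one, axis_X]

/-- A squarefree monomial of degree at least `2` contains a variable other than `x_i`, so it
vanishes on the `i`-th axis. For `k ≥ 1` the same holds for `x_j ^ k` with `j ≠ i`. -/
theorem X_pow_dvd_axis (hk : 1 ≤ k) (i : Fin (a + 1)) {f : MvPolynomial (Fin (a + 1)) K}
    (hf : f ∈ griffinIdeal K (a + 1) k (oneRow a)) : Polynomial.X ^ k ∣ axis K i f := by
  rw [← Ideal.mem_span_singleton]
  refine (Ideal.span_le (I := (Ideal.span {Polynomial.X ^ k}).comap (axis K i))).2 ?_ hf
  rintro f (⟨j, rfl⟩ | ⟨A, r, h1, h2, rfl⟩)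
  · rw [SetLike.mem_coe, Ideal.mem_comap, Ideal.mem_span_singleton, map_pow, axis_X]
    split_ifs
    · exact dvd_rfl
    · rw [zero_pow (by omega)]
      exact dvd_zero _
  · rw [griffin_bound_oneRow_iff h2] at h1
    rw [SetLike.mem_coe, Ideal.mem_comap, partialEsymm, map_sum]
    refine Ideal.sum_mem _ fun B hB => ?_
    have hB' : 1 < B.card := by
      rw [(Finset.mem_powersetCard.1 hB).2]
      omega
    obtain ⟨j, hj, hji⟩ := Finset.exists_mem_ne hB' i
    rw [map_prod, Finset.prod_eq_zero hj (by rw [axis_X, if_neg hji])]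
    exact Ideal.zero_mem _

/-- The coefficient of `x_i ^ d` as a linear form on the ring `R_{n,k,(n-1)}`, for `d < k`. -/
noncomputable def axisCoeff (K : Type*) [Field K] (a k : ℕ) (i : Fin (a + 1)) {d : ℕ}
    (hd : d < k) : GriffinRing K (a + 1) k (oneRow a) →ₗ[K] K where
  toAddHom := (QuotientAddGroup.lift (Submodule.toAddSubgroup (griffinIdeal K (a + 1) k (oneRow a)))
    ((Polynomial.lcoeff K d).toAddMonoidHom.comp (axis K i).toLinearMap.toAddMonoidHom)
    fun f hf => Polynomial.X_pow_dvd_iff.1 (X_pow_dvd_axis (by omega) i hf) d hd :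
      GriffinRing K (a + 1) k (oneRow a) →+ K).toAddHom
  map_smul' c x := by
    obtain ⟨f, rfl⟩ := Ideal.Quotient.mk_surjective x
    change (axis K i (c • f)).coeff d = c • (axis K i f).coeff d
    rw [map_smul, Polynomial.coeff_smul]

theorem axisCoeff_mk (i : Fin (a + 1)) {d : ℕ} (hd : d < k) (f : MvPolynomial (Fin (a + 1)) K) :
    axisCoeff K a k i hd (Ideal.Quotient.mk _ f) = (axis K i f).coeff d := rfl

/-- The map `f ↦ f e_1 ^ d` from the polynomial ring to the quotient `R_{n,k,μ}`. -/
noncomputable def mulE (K : Type*) [Field K] (n k : ℕ) (mu : YoungDiagram) (d : ℕ) :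
    MvPolynomial (Fin n) K →ₗ[K] GriffinRing K n k mu :=
  (Ideal.Quotient.mkₐ K (griffinIdeal K n k mu)).toLinearMap ∘ₗ
    LinearMap.mulRight K (esymm (Fin n) K 1 ^ d)

theorem mulE_apply {n k : ℕ} {mu : YoungDiagram} (d : ℕ) (f : MvPolynomial (Fin n) K) :
    mulE K n k mu d f = Ideal.Quotient.mk _ (f * esymm (Fin n) K 1 ^ d) := rfl

theorem mulE_equivariant {n k : ℕ} {mu : YoungDiagram} (d : ℕ) (s : Equiv.Perm (Fin n))
    (f : MvPolynomial (Fin n) K) :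
    mulE K n k mu d (polyRep K n s f) = griffinRep K n k mu s (mulE K n k mu d f) := by
  change Ideal.Quotient.mk _ (rename s f * esymm (Fin n) K 1 ^ d) =
    Ideal.Quotient.mk _ (rename s (f * esymm (Fin n) K 1 ^ d))
  rw [map_mul (rename s), map_pow (rename s), rename_esymm]

/-- On every axis `e_1` restricts to the coordinate, so multiplication by `e_1 ^ r` shifts degrees
by `r`. -/
theorem axisCoeff_mulE (i : Fin (a + 1)) {d : ℕ} (hd : d < k) (r : ℕ)
    (f : MvPolynomial (Fin (a + 1)) K) :
    axisCoeff K a k i hd (mulE K (a + 1) k (oneRow a) r f) =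
      if r ≤ d then (axis K i f).coeff (d - r) else 0 := by
  rw [mulE_apply, axisCoeff_mk, map_mul, map_pow, axis_esymm_one, Polynomial.coeff_mul_X_pow']

/-- In `x_i e_1` all mixed products vanish in the quotient, which leaves `x_i ^ 2`. -/
theorem mulE_X (i : Fin (a + 1)) (d : ℕ) :
    mulE K (a + 1) k (oneRow a) d (X i) = Ideal.Quotient.mk _ (X i ^ (d + 1)) := by
  induction d with
  | zero => rw [mulE_apply, pow_zero, mul_one, zero_add, pow_one]
  | succ d ih =>
    have h : (Ideal.Quotient.mk (griffinIdeal K (a + 1) k (oneRow a))) (X i * esymm _ K 1) =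
        Ideal.Quotient.mk _ (X i ^ 2) := by
      rw [Ideal.Quotient.eq, esymm_one, Finset.mul_sum, ← Finset.add_sum_erase _ _
        (Finset.mem_univ i), pow_two, add_sub_cancel_left]
      exact Ideal.sum_mem _ fun j hj =>
        X_mul_X_mem_griffinIdeal (Finset.ne_of_mem_erase hj).symm
    rw [mulE_apply] at ih ⊢
    rw [pow_succ, ← mul_assoc, map_mul, ih, ← map_mul, pow_succ, mul_assoc, map_mul, h, ← map_mul]
    ring_nf

/-- The ring `R_{n,k,(n-1)}` is spanned by `1` and the powers of the variables. -/
theorem eq_top_of_forall_pow_mem (N : Submodule K (GriffinRing K (a + 1) k (oneRow a)))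
    (h1 : (1 : GriffinRing K (a + 1) k (oneRow a)) ∈ N)
    (hX : ∀ i d, Ideal.Quotient.mk (griffinIdeal K (a + 1) k (oneRow a)) (X i ^ (d + 1)) ∈ N) :
    N = ⊤ := by
  set s : Set (GriffinRing K (a + 1) k (oneRow a)) :=
    insert 1 (Set.range fun p : Fin (a + 1) × ℕ => Ideal.Quotient.mk _ (X p.1 ^ (p.2 + 1)))
    with hs
  have hsN : Submodule.span K s ≤ N := by
    rw [Submodule.span_le]
    rintro _ (rfl | ⟨p, rfl⟩)
    · exact h1
    · exact hX p.1 p.2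
  rw [eq_top_iff]
  refine le_trans ?_ hsN
  rintro x -
  obtain ⟨f, rfl⟩ := Ideal.Quotient.mk_surjective x
  induction f using MvPolynomial.induction_on with
  | C c =>
    rw [show (C c : MvPolynomial (Fin (a + 1)) K) = c • 1 by rw [smul_eq_C_mul, mul_one]]
    have hmem : (1 : GriffinRing K (a + 1) k (oneRow a)) ∈ Submodule.span K s :=
      Submodule.subset_span (Or.inl rfl)
    exact Submodule.smul_mem _ c hmem
  | add p q hp hq => rw [map_add]; exact Submodule.add_mem _ hp hq
  | mul_X p i hp =>
    rw [map_mul]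
    -- It remains to see that the span is stable under multiplication by `x_i`, which is checked on
    -- the spanning set.
    generalize Ideal.Quotient.mk (griffinIdeal K (a + 1) k (oneRow a)) p = x at hp
    induction hp using Submodule.span_induction with
    | mem x hx =>
      rcases hx with rfl | ⟨⟨j, d⟩, rfl⟩
      · rw [one_mul]
        exact Submodule.subset_span (Or.inr ⟨(i, 0), by simp⟩)
      · rw [← map_mul]
        by_cases hij : j = i
        · subst hij
          exact Submodule.subset_span (Or.inr ⟨(j, d + 1), by rw [← pow_succ]⟩)
        · rw [pow_succ, mul_assoc, Ideal.Quotient.eq_zero_iff_mem.2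
            (Ideal.mul_mem_left _ _ (X_mul_X_mem_griffinIdeal hij))]
          exact Submodule.zero_mem _
    | zero => rw [zero_mul]; exact Submodule.zero_mem _
    | add x y _ _ hx hy => rw [add_mul]; exact Submodule.add_mem _ hx hy
    | smul c x _ hx => rw [smul_mul_assoc]; exact Submodule.smul_mem _ c hx

end Ring

/-! ### The Specht modules of shapes `(n)` and `(n - 1, 1)` -/

section Specht

variable (K : Type*) [Field K] {m : ℕ}

theorem spechtModule_oneRow (n : ℕ) :
    (spechtModule K n (oneRow n)).toSubmodule = Submodule.span K {1} := by
  change Submodule.span K (Set.range fun T : Tab (oneRow n) n => spechtPoly K T) = _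
  have : Nonempty (Tab (oneRow n) n) := ⟨(oneRowCells n).symm⟩
  simp only [spechtPoly_oneRow, Set.range_const]

/-- A Specht polynomial of this shape is some `x_b - x_c`, and this equals `(x_b - x_0) - (x_c -
x_0)`. -/
theorem spechtModule_twoRow (h : 1 ≤ m + 1) :
    (spechtModule K (m + 2) (twoRow (m + 1) 1 h)).toSubmodule =
      Submodule.span K (Set.range fun b : {b : Fin (m + 2) // b ≠ 0} =>
        (X b.1 - X 0 : MvPolynomial (Fin (m + 2)) K)) := by
  refine le_antisymm (Submodule.span_le.2 ?_) (Submodule.span_le.2 ?_)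
  · have hmem : ∀ b : Fin (m + 2), (X b - X 0 : MvPolynomial (Fin (m + 2)) K) ∈
        Submodule.span K (Set.range fun b : {b : Fin (m + 2) // b ≠ 0} =>
          (X b.1 - X 0 : MvPolynomial (Fin (m + 2)) K)) := fun b => by
      by_cases hb : b = 0
      · rw [hb, sub_self]
        exact Submodule.zero_mem _
      · exact Submodule.subset_span ⟨⟨b, hb⟩, rfl⟩
    rintro _ ⟨T, rfl⟩
    have := Submodule.sub_mem _ (hmem (T (twoRowCells (m + 1) h none)))
      (hmem (T (twoRowCells (m + 1) h (some 0))))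
    rw [sub_sub_sub_cancel_right] at this
    simp only [spechtPoly_twoRow]
    exact this
  · rintro _ ⟨⟨b, hb⟩, rfl⟩
    refine Submodule.subset_span ⟨hookTab h b, ?_⟩
    simp only [spechtPoly_twoRow, hookTab_top, hookTab_bottom, Fin.succAbove_ne_zero_zero hb]

/-- The coefficients of the `x_c` with `c ≠ 0` form a dual family. -/
theorem linearIndependent_X_sub_X (n : ℕ) [NeZero n] :
    LinearIndependent K fun b : {b : Fin n // b ≠ 0} =>
      (X b.1 - X 0 : MvPolynomial (Fin n) K) := by
  have hdual : ∀ b c : {b : Fin n // b ≠ 0},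
      (axis K c.1 (X b.1 - X 0)).coeff 1 = if b = c then 1 else 0 := fun b c => by
    rw [map_sub, axis_X, axis_X, if_neg c.2.symm, sub_zero]
    by_cases hbc : b = c
    · simp [hbc]
    · simp [hbc, Subtype.ext_iff.not.1 hbc]
  rw [Fintype.linearIndependent_iff]
  intro g hg c
  have := congrArg (fun f => (axis K c.1 f).coeff 1) hg
  simpa only [map_sum, map_smul, Polynomial.finsetSum_coeff, Polynomial.coeff_smul, hdual,
    smul_eq_mul, mul_ite, mul_one, mul_zero, Finset.sum_ite_eq', Finset.mem_univ, if_true, map_zero,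
    Polynomial.coeff_zero] using this

/-- An element of the Specht module of shape `(n - 1, 1)` is a linear form whose coefficients add
up to zero. -/
theorem eq_sum_of_mem_spechtModule_twoRow {h : 1 ≤ m + 1} {f : MvPolynomial (Fin (m + 2)) K}
    (hf : f ∈ (spechtModule K (m + 2) (twoRow (m + 1) 1 h)).toSubmodule) :
    f = ∑ i, (axis K i f).coeff 1 • X i ∧ ∑ i, (axis K i f).coeff 1 = 0 := by
  rw [spechtModule_twoRow] at hf
  induction hf using Submodule.span_induction with
  | mem x hx =>
    obtain ⟨b, rfl⟩ := hx
    have : ∀ i, (axis K i (X b.1 - X 0)).coeff 1 =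
        (if b.1 = i then 1 else 0) - (if (0 : Fin (m + 2)) = i then (1 : K) else 0) := fun i => by
      rw [map_sub, axis_X, axis_X, Polynomial.coeff_sub]
      split_ifs <;> simp
    simp only [this, sub_smul, Finset.sum_sub_distrib, ite_smul, one_smul, zero_smul,
      Finset.sum_ite_eq, Finset.mem_univ, if_true, sub_self, and_self]
  | zero => simp
  | add x y _ _ hx hy =>
    simp only [map_add, Polynomial.coeff_add, add_smul, Finset.sum_add_distrib]
    exact ⟨by rw [← hx.1, ← hy.1], by rw [hx.2, hy.2, add_zero]⟩
  | smul c x _ hx =>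
    simp only [map_smul, Polynomial.coeff_smul, smul_assoc, ← Finset.smul_sum]
    exact ⟨by rw [← hx.1], by rw [hx.2, smul_zero]⟩

end Specht

/-! ### The index set -/

/-- The standard tableaux of shapes `(n)` and `(n - 1, 1)`, the latter given by their top entry. -/
abbrev StdIndex (m k : ℕ) : Fin k ⊕ Fin (k - 1) → Type :=
  Sum.elim (fun _ => Unit) fun _ => {b : Fin (m + 2) // b ≠ 0}

/-- The elements of the index set for content `(n - 1, 1)`, with `n = m + 2`. -/
def spechtIndexOf (m k : ℕ) (h : 1 ≤ m + 1) :
    (Σ j, StdIndex m k j) → SpechtIndex (m + 2) k (twoRow (m + 1) 1 h)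
  | ⟨Sum.inl i, _⟩ => ⟨oneRow (m + 2), oneRowTableau (m + 1), hasContent_oneRowTableau _ h,
      (oneRowCells (m + 2)).symm, isStandard_oneRowCells_symm _, i, by
        rw [des_oneRowTableau]
        exact i.2⟩
  | ⟨Sum.inr i, b⟩ => ⟨twoRow (m + 1) 1 h, twoRowTableau (m + 1) h, hasContent_twoRowTableau _ h,
      hookTab h b.1, isStandard_hookTab b.2, i, by
        rw [des_twoRowTableau]
        omega⟩

theorem oneRow_ne_twoRow (a b c : ℕ) (hc : 1 ≤ c) (hcb : c ≤ b) : oneRow a ≠ twoRow b c hcb := by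
  intro e
  have h10 : ((1, 0) : ℕ × ℕ) ∈ twoRow b c hcb := mem_twoRow.2 (Or.inr ⟨rfl, hc⟩)
  rw [← e, mem_oneRow] at h10
  exact one_ne_zero h10.1

/-- Injectivity: the shape, the exponent and the top entry of `T` recover the index. Surjectivity is
the classification of the tableaux, together with `des = 0` or `1`, which accounts for the ranges
`Fin k` and `Fin (k - 1)` of the exponent. -/
theorem spechtIndexOf_bijective {m k : ℕ} {h : 1 ≤ m + 1} :
    Function.Bijective (spechtIndexOf m k h) := by
  constructor
  · rintro ⟨i | i, x⟩ ⟨i' | i', x'⟩ e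
    · have e' := congrArg SpechtIndex.i e
      obtain rfl : i = i' := Fin.ext e'
      rfl
    · exact absurd (congrArg SpechtIndex.shape e) (oneRow_ne_twoRow _ _ _ le_rfl h)
    · exact absurd (congrArg SpechtIndex.shape e).symm (oneRow_ne_twoRow _ _ _ le_rfl h)
    · have e' := congrArg SpechtIndex.i e
      obtain rfl : i = i' := Fin.ext e'
      simp only [spechtIndexOf, SpechtIndex.mk.injEq, heq_eq_eq, true_and, and_true] at e
      have := congrArg (fun T : Tab (twoRow (m + 1) 1 h) (m + 2) =>
        T (twoRowCells (m + 1) h none)) e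
      simp only [hookTab_top] at this
      obtain rfl : x = x' := Subtype.ext this
      rfl
  · rintro ⟨lam, S, hS, T, hT, i, hi⟩
    have hcard : lam.card = m + 1 + 1 := by
      -- The size of the shape is not recorded in the index; it comes from the bijection `T`.
      have := Fintype.card_congr T
      rwa [Fintype.card_coe, Fintype.card_fin] at this
    rcases hS.shape_eq hcard with rfl | rfl
    · obtain rfl := hS.eq_oneRowTableau
      obtain rfl := hT.eq_oneRowCells_symm
      exact ⟨⟨Sum.inl ⟨i, by omega⟩, ()⟩, rfl⟩
    · obtain rfl := hS.eq_twoRowTableau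
      have hi' := hi
      rw [des_twoRowTableau] at hi'
      refine ⟨⟨Sum.inr ⟨i, by omega⟩, ⟨_, hT.top_ne_zero⟩⟩, ?_⟩
      simp only [spechtIndexOf, ← hT.eq_hookTab]

end HigherSpecht

/-! ### Decomposition of the ring into blocks -/

namespace HigherSpecht

open MvPolynomial

/-! ### The higher Specht basis -/

section Basis

variable (K : Type*) [Field K] (m k : ℕ) (h : 1 ≤ m + 1)

/-- The shape of a block of the index set. -/
def blockShape : Fin k ⊕ Fin (k - 1) → YoungDiagram :=
  Sum.elim (fun _ => oneRow (m + 2)) fun _ => twoRow (m + 1) 1 h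

/-- The exponent of `e_1` in a block of the index set. -/
def blockExp : Fin k ⊕ Fin (k - 1) → ℕ := Sum.elim (fun i => i) fun i => i

/-- The higher Specht polynomials of a block of the index set. -/
noncomputable def blockPoly (j : Fin k ⊕ Fin (k - 1)) (x : StdIndex m k j) :
    MvPolynomial (Fin (m + 2)) K :=
  higherSpecht K (spechtIndexOf m k h ⟨j, x⟩).S (spechtIndexOf m k h ⟨j, x⟩).T

/-- Linear conditions that hold on all blocks but the `j`-th. -/
noncomputable def blockCompl :
    Fin k ⊕ Fin (k - 1) → Submodule K (GriffinRing K (m + 2) k (oneRow (m + 1)))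
  | Sum.inl i => LinearMap.ker (∑ x, axisCoeff K (m + 1) k x i.2)
  | Sum.inr i => ⨅ x, ⨅ y, LinearMap.ker (axisCoeff K (m + 1) k x (d := i + 1) (by omega) -
      axisCoeff K (m + 1) k y (d := i + 1) (by omega))

variable {m k h}

theorem mk_poly_spechtIndexOf (j : Fin k ⊕ Fin (k - 1)) (x : StdIndex m k j) :
    Ideal.Quotient.mk (griffinIdeal K (m + 2) k (oneRow (m + 1)))
      ((spechtIndexOf m k h ⟨j, x⟩).poly K) =
    mulE K (m + 2) k (oneRow (m + 1)) (blockExp k j) (blockPoly K m k h j x) := by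
  rcases j with i | i <;> rfl

theorem exists_blockPoly_inl [CharZero K] (i : Fin k) :
    ∃ c : Unit → Kˣ, blockPoly K m k h (Sum.inl i) =
      (c • (fun _ => 1 : Unit → MvPolynomial (Fin (m + 2)) K) :) := by
  have hne : (Tab.rowPerms ((oneRowCells (m + 2)).symm : Tab _ _)).card ≠ 0 :=
    Tab.card_rowPerms_ne_zero _
  refine ⟨fun _ => Units.mk0 _ (Nat.cast_ne_zero.2 hne), _root_.funext fun _ => ?_⟩
  exact higherSpecht_oneRowTableau K _

/-- The factors `|R(T)|` are units in characteristic zero, so they affect neither independence nor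
spans. -/
theorem exists_blockPoly_inr [CharZero K] (i : Fin (k - 1)) :
    ∃ c : {b : Fin (m + 2) // b ≠ 0} → Kˣ,
      blockPoly K m k h (Sum.inr i) = (c • (fun b => X b.1 - X 0 :
        {b : Fin (m + 2) // b ≠ 0} → MvPolynomial (Fin (m + 2)) K) :) := by
  have hne : ∀ b : {b : Fin (m + 2) // b ≠ 0}, ((hookTab h b.1).rowPerms.card : K) ≠ 0 :=
    fun b => Nat.cast_ne_zero.2 (Tab.card_rowPerms_ne_zero _)
  refine ⟨fun b => Units.mk0 _ (hne b), _root_.funext fun b => ?_⟩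
  change higherSpecht K (twoRowTableau (m + 1) h) (hookTab h b.1) = _
  rw [higherSpecht_twoRowTableau, hookTab_top, hookTab_bottom, Fin.succAbove_ne_zero_zero b.2]
  rfl

theorem linearIndependent_blockPoly [CharZero K] (j : Fin k ⊕ Fin (k - 1)) :
    LinearIndependent K (blockPoly K m k h j) := by
  rcases j with i | i
  · obtain ⟨c, hc⟩ := exists_blockPoly_inl K (m := m) (h := h) i
    have hli : LinearIndependent K fun _ : Unit => (1 : MvPolynomial (Fin (m + 2)) K) :=
      LinearIndependent.of_subsingleton () one_ne_zero
    exact hc ▸ hli.units_smul c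
  · obtain ⟨c, hc⟩ := exists_blockPoly_inr K (m := m) (h := h) i
    exact hc ▸ (linearIndependent_X_sub_X K (m + 2)).units_smul c

theorem span_range_units_smul {ι V : Type*} [AddCommGroup V] [Module K V] (c : ι → Kˣ)
    (v : ι → V) : Submodule.span K (Set.range (c • v)) = Submodule.span K (Set.range v) := by
  refine le_antisymm (Submodule.span_le.2 ?_) (Submodule.span_le.2 ?_)
  · rintro _ ⟨i, rfl⟩
    exact Submodule.smul_mem _ (c i : K) (Submodule.subset_span ⟨i, rfl⟩)
  · rintro _ ⟨i, rfl⟩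
    have := Submodule.smul_mem _ ((c i)⁻¹ : K)
      (Submodule.subset_span (R := K) (Set.mem_range_self (f := c • v) i))
    simpa [Units.smul_def, smul_smul] using this

theorem span_blockPoly [CharZero K] (j : Fin k ⊕ Fin (k - 1)) :
    Submodule.span K (Set.range (blockPoly K m k h j)) =
      (spechtModule K (m + 2) (blockShape m k h j)).toSubmodule := by
  rcases j with i | i
  · obtain ⟨c, hc⟩ := exists_blockPoly_inl K (m := m) (h := h) i
    refine (congrArg (fun f => Submodule.span K (Set.range f)) hc).trans ?_
    refine (span_range_units_smul K c _).trans ?_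
    rw [Set.range_const]
    exact (spechtModule_oneRow K (m + 2)).symm
  · obtain ⟨c, hc⟩ := exists_blockPoly_inr K (m := m) (h := h) i
    refine (congrArg (fun f => Submodule.span K (Set.range f)) hc).trans ?_
    exact (span_range_units_smul K c _).trans (spechtModule_twoRow K h).symm

/-- For a constant `c` the condition says `n c = 0`. For a linear form with coefficient sum zero it
says that all coefficients agree, so `n` times their common value is zero. Both the injectivity of
`mulE` on the Specht module and the independence of the blocks rest on this. -/
theorem eq_zero_of_mulE_mem_blockCompl [CharZero K] (j : Fin k ⊕ Fin (k - 1))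
    {f : MvPolynomial (Fin (m + 2)) K}
    (hf : f ∈ (spechtModule K (m + 2) (blockShape m k h j)).toSubmodule)
    (hZ : mulE K (m + 2) k (oneRow (m + 1)) (blockExp k j) f ∈ blockCompl K m k j) : f = 0 := by
  rcases j with i | i
  · replace hf : f ∈ (spechtModule K (m + 2) (oneRow (m + 2))).toSubmodule := hf
    rw [spechtModule_oneRow, Submodule.mem_span_singleton] at hf
    obtain ⟨c, rfl⟩ := hf
    simp only [blockCompl, blockExp, Sum.elim_inl, LinearMap.mem_ker, LinearMap.sum_apply,
      axisCoeff_mulE, le_refl, if_true, Nat.sub_self, map_smul, map_one, Polynomial.coeff_one_zero,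
      smul_eq_mul, mul_one, Finset.sum_const, Finset.card_univ,
      Fintype.card_fin, nsmul_eq_mul, mul_eq_zero, Nat.cast_eq_zero] at hZ
    rw [hZ.resolve_right (by omega), zero_smul]
  · obtain ⟨h1, h2⟩ := eq_sum_of_mem_spechtModule_twoRow K (h := h) hf
    simp only [blockCompl, blockExp, Sum.elim_inr, Submodule.mem_iInf, LinearMap.mem_ker,
      LinearMap.sub_apply, axisCoeff_mulE, Nat.le_succ, if_true, Nat.add_sub_cancel_left,
      sub_eq_zero] at hZ
    have hconst : ∀ x, (axis K x f).coeff 1 = (axis K 0 f).coeff 1 := fun x => hZ x 0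
    simp only [hconst, Finset.sum_const, Finset.card_univ, Fintype.card_fin, nsmul_eq_mul,
      mul_eq_zero, Nat.cast_eq_zero] at h2
    rw [h1]
    refine Finset.sum_eq_zero fun x _ => ?_
    rw [hconst, h2.resolve_left (by omega), zero_smul]

/-- Blocks of the same kind live in different degrees. Blocks of different kinds are separated in
every degree: constants times powers of `e_1` have equal coefficients on all axes, and the forms in
`V_(n-1,1)` give coefficient sum zero. -/
theorem mulE_mem_blockCompl {j l : Fin k ⊕ Fin (k - 1)} (hlj : l ≠ j)
    {f : MvPolynomial (Fin (m + 2)) K}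
    (hf : f ∈ (spechtModule K (m + 2) (blockShape m k h l)).toSubmodule) :
    mulE K (m + 2) k (oneRow (m + 1)) (blockExp k l) f ∈ blockCompl K m k j := by
  rcases l with l | l
  · replace hf : f ∈ (spechtModule K (m + 2) (oneRow (m + 2))).toSubmodule := hf
    rw [spechtModule_oneRow, Submodule.mem_span_singleton] at hf
    obtain ⟨c, rfl⟩ := hf
    rcases j with i | i
    · have hil : l.1 ≤ i.1 → i.1 - l.1 ≠ 0 := fun hle => by
        have : l.1 ≠ i.1 := fun e => hlj (congrArg Sum.inl (Fin.ext e))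
        omega
      simp only [blockCompl, blockExp, Sum.elim_inl, LinearMap.mem_ker, LinearMap.sum_apply,
        axisCoeff_mulE, map_smul, map_one, Polynomial.coeff_one]
      split_ifs with h1 h2
      · exact absurd h2 (hil h1)
      · simp
      · simp
    · simp only [blockCompl, blockExp, Sum.elim_inl, Submodule.mem_iInf, LinearMap.mem_ker,
        LinearMap.sub_apply, axisCoeff_mulE, map_smul, map_one, sub_self, smul_zero, implies_true]
  · obtain ⟨h1, h2⟩ := eq_sum_of_mem_spechtModule_twoRow K (h := h) hf
    have hcoeff : ∀ (x : Fin (m + 2)) (d : ℕ), d ≠ 1 → (axis K x f).coeff d = 0 := by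
      intro x d hd
      rw [h1, map_sum, Polynomial.finsetSum_coeff]
      refine Finset.sum_eq_zero fun y _ => ?_
      rw [map_smul, Polynomial.coeff_smul, axis_X]
      split_ifs
      · rw [Polynomial.coeff_X_of_ne_one hd, smul_zero]
      · rw [Polynomial.coeff_zero, smul_zero]
    rcases j with i | i
    · simp only [blockCompl, blockExp, Sum.elim_inr, LinearMap.mem_ker, LinearMap.sum_apply,
        axisCoeff_mulE]
      split_ifs with hle
      -- Degree `1` of `f` is the only one with nonzero axis coefficients, and there they add up to
      -- zero.
      · by_cases hd : i.1 - l.1 = 1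
        · rw [hd, h2]
        · exact Finset.sum_eq_zero fun x _ => hcoeff x _ hd
      · exact Finset.sum_const_zero
    · have hil : l.1 ≤ i.1 + 1 → i.1 + 1 - l.1 ≠ 1 := fun hle => by
        have : l.1 ≠ i.1 := fun e => hlj (congrArg Sum.inr (Fin.ext e))
        omega
      simp only [blockCompl, blockExp, Sum.elim_inr, Submodule.mem_iInf, LinearMap.mem_ker,
        LinearMap.sub_apply, axisCoeff_mulE]
      intro x y
      split_ifs with hle
      · rw [hcoeff x _ (hil hle), hcoeff y _ (hil hle), sub_zero]
      · rw [sub_zero]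

/-- By `mulE_X` the power `x_b ^ (d + 1)` is the image of `x_b e_1 ^ d`. As `n` is invertible, `x_b`
splits into a multiple of `e_1` and a combination of differences, which land in the trivial and the
other block of degree `d + 1`. -/
theorem iSup_map_mulE_eq_top [CharZero K] (hk : 1 ≤ k) :
    ⨆ j, (spechtModule K (m + 2) (blockShape m k h j)).toSubmodule.map
      (mulE K (m + 2) k (oneRow (m + 1)) (blockExp k j)) = ⊤ := by
  set N := ⨆ j, (spechtModule K (m + 2) (blockShape m k h j)).toSubmodule.map
      (mulE K (m + 2) k (oneRow (m + 1)) (blockExp k j)) with hN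
  have hone : ∀ i, i < k → mulE K (m + 2) k (oneRow (m + 1)) i 1 ∈ N := fun i hi => by
    refine Submodule.mem_iSup_of_mem (Sum.inl ⟨i, hi⟩) (Submodule.mem_map_of_mem ?_)
    change 1 ∈ (spechtModule K (m + 2) (oneRow (m + 2))).toSubmodule
    rw [spechtModule_oneRow]
    exact Submodule.mem_span_singleton_self 1
  have hsub : ∀ i, i + 1 < k → ∀ b, mulE K (m + 2) k (oneRow (m + 1)) i (X b - X 0) ∈ N :=
    fun i hi b => by
      by_cases hb : b = 0
      · rw [hb, sub_self, map_zero]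
        exact Submodule.zero_mem _
      · refine Submodule.mem_iSup_of_mem (Sum.inr ⟨i, by omega⟩) (Submodule.mem_map_of_mem ?_)
        change _ ∈ (spechtModule K (m + 2) (twoRow (m + 1) 1 h)).toSubmodule
        rw [spechtModule_twoRow]
        exact Submodule.subset_span ⟨⟨b, hb⟩, rfl⟩
  refine eq_top_of_forall_pow_mem N ?_ fun b d => ?_
  · simpa [mulE_apply] using hone 0 hk
  · by_cases hd : d + 1 < k
    · rw [← mulE_X]
      have hsum : ((m + 2 : ℕ) : K) • (X b : MvPolynomial (Fin (m + 2)) K) =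
          esymm (Fin (m + 2)) K 1 + ∑ c, ((X b - X 0) - (X c - X 0)) := by
        simp only [sub_sub_sub_cancel_right, Finset.sum_sub_distrib, esymm_one, Finset.sum_const,
          Finset.card_univ, Fintype.card_fin, Nat.cast_smul_eq_nsmul]
        abel
      have hne : ((m + 2 : ℕ) : K) ≠ 0 := Nat.cast_ne_zero.2 (by omega)
      rw [← N.smul_mem_iff hne, ← map_smul, hsum, map_add, map_sum]
      refine N.add_mem ?_ (N.sum_mem fun c _ => ?_)
      -- The term `e_1` times `e_1 ^ d` is regarded as `1` times `e_1 ^ (d + 1)`, an element of the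
      -- trivial block.
      · have := hone (d + 1) hd
        rwa [mulE_apply, one_mul, pow_succ', ← mulE_apply] at this
      · rw [map_sub]
        exact N.sub_mem (hsub d hd b) (hsub d hd c)
    · rw [Ideal.Quotient.eq_zero_iff_mem.2]
      · exact N.zero_mem
      · exact Ideal.pow_mem_of_pow_mem _ (X_pow_mem_griffinIdeal b) (not_lt.1 hd)

theorem isHigherSpechtBasis_griffinRep_oneRow [CharZero K] (hk : 1 ≤ k) :
    IsHigherSpechtBasis (griffinRep K (m + 2) k (oneRow (m + 1)))
      (fun a : SpechtIndex (m + 2) k (twoRow (m + 1) 1 h) =>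
        Ideal.Quotient.mk (griffinIdeal K (m + 2) k (oneRow (m + 1))) (a.poly K)) := by
  have hker : ∀ j, Disjoint (spechtModule K (m + 2) (blockShape m k h j)).toSubmodule
      (LinearMap.ker (mulE K (m + 2) k (oneRow (m + 1)) (blockExp k j))) := fun j => by
    rw [Submodule.disjoint_def]
    intro f hf h0
    refine eq_zero_of_mulE_mem_blockCompl K j hf ?_
    rw [LinearMap.mem_ker.1 h0]
    exact Submodule.zero_mem _
  refine isHigherSpechtBasis_of_sigma (Equiv.ofBijective _ spechtIndexOf_bijective)
    (blockShape m k h)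
    (fun j => mapSubrep (mulE K (m + 2) k (oneRow (m + 1)) (blockExp k j))
      (mulE_equivariant _) (spechtModule K (m + 2) (blockShape m k h j)))
    ?_ (fun j => nonempty_equiv_mapSubrep _ _ _ (hker j)) ?_ (iSup_map_mulE_eq_top K hk) ?_ ?_
  · rintro (i | i)
    · exact card_oneRow _
    · exact card_twoRow_one _ h
  · refine iSupIndep_of_disjoint (Z := blockCompl K m k) ?_ fun j => ?_
    · rintro j l hlj _ ⟨f, hf, rfl⟩
      exact mulE_mem_blockCompl K hlj hf
    · rw [Submodule.disjoint_def]
      rintro _ ⟨f, hf, rfl⟩ hZ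
      rw [eq_zero_of_mulE_mem_blockCompl K j hf hZ, map_zero]
  · intro j
    simp only [Equiv.ofBijective_apply, mk_poly_spechtIndexOf]
    refine (linearIndependent_blockPoly K j).map ?_
    rw [span_blockPoly]
    exact hker j
  · intro j
    simp only [Equiv.ofBijective_apply, mk_poly_spechtIndexOf]
    change _ = (spechtModule K (m + 2) (blockShape m k h j)).toSubmodule.map _
    rw [← span_blockPoly, Submodule.map_span, ← Set.range_comp]
    rfl

end Basis

end HigherSpecht

theorem mainTheorem3 (n k : ℕ) (hn : 2 ≤ n) (hk : 1 ≤ k) :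
    HigherSpecht.IsHigherSpechtBasis
      (HigherSpecht.griffinRep ℂ n k (HigherSpecht.oneRow (n - 1)))
      (fun a : HigherSpecht.SpechtIndex n k (HigherSpecht.twoRow (n - 1) 1 (by omega)) =>
        Ideal.Quotient.mk (HigherSpecht.griffinIdeal ℂ n k (HigherSpecht.oneRow (n - 1)))
          (a.poly ℂ)) := by
  obtain ⟨m, rfl⟩ := Nat.exists_eq_add_of_le' hn
  exact HigherSpecht.isHigherSpechtBasis_griffinRep_oneRow ℂ hk
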